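/- Consider the \textsc{$k$-Dominating Set} problem, parameterized by $k$: given a finite simple undirected graph $G$ and an integer $k\ge 1$, decide whether $G$ has a set $S$ of at most $k$ vertices such that every vertex outside $S$ has a neighbor in $S$. A graph is $d$-degenerate if each of its nonempty subgraphs has a vertex of degree at most $d$ in that subgraph. There is an absolute constant $C$ such that for every fixed $d\ge 1$ there are an algorithm (a program for a unit-cost RAM with addition, truncated subtraction, comparison and indirect addressing; graphs are given by their number of vertices and a list of their edges) and a function $h\colon\mathbb{N}\to\mathbb{N}$ with the following property. For every $d$-degenerate graph $G$ on $n$ vertices and every integer $k\ge1$, the algorithm, on input $(G,k)$, halts after at most $C\cdot 2^{d}\cdot d\cdot \max(n,1)^{2}$ steps and outputs a graph $G'$ and an integer $k'\ge 0$ such that 1. $G$ has a dominating set of size at most $k$ if and only if $G'$ has a dominating set of size at most $k'$; 2. $G'$ is $d$-degenerate, and has at most $C\cdot (d+2)^{2(d+2)}\cdot k^{2(d+1)^{2}}$ vertices and at most $C\cdot (d+2)^{2(d+2)}\cdot k^{2(d+1)^{2}}$ edges; 3. $k'\le h(k)$. In other words, for any fixed $d\ge 1$, \textsc{$k$-Dominating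 Set} on $d$-degenerate graphs has a kernel with $O((d+2)^{2(d+2)}k^{2(d+1)^2})$ vertices and edges, and this kernel can be computed in $O(2^{d}\cdot d\,n^{2})$ time. -/

import Mathlib

/-! ### Graph notions -/

/-- `G` is `d`-degenerate: every (nonempty) subgraph of `G` has a vertex of degree at most `d`. -/
def IsDegenerate {V : Type*} (G : SimpleGraph V) (d : ℕ) : Prop :=
  ∀ H : G.Subgraph, H.verts.Nonempty → ∃ v ∈ H.verts, (H.neighborSet v).encard ≤ d

/-- Every vertex outside `S` is adjacent to some vertex of `S`. -/
def IsDominating {V : Type*} (G : SimpleGraph V) (S : Finset V) : Prop :=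
  ∀ u, u ∉ S → ∃ v ∈ S, G.Adj u v

/-- `G` has a dominating set of size at most `k`. -/
def HasDominatingSet {V : Type*} (G : SimpleGraph V) (k : ℕ) : Prop :=
  ∃ S : Finset V, S.card ≤ k ∧ IsDominating G S

/-! ### The machine: a unit-cost RAM

A machine has registers and zero-based arrays of unbounded length, all holding natural numbers.
A program mentions finitely many registers and arrays. Arithmetic consists of addition and
truncated subtraction only. Arrays are accessed at an address held in a register, which is
indirect addressing. Control flow is structured. -/

/-- The content of the registers and of the arrays. -/
structure RAMState where
  reg : ℕ → ℕ
  arr : ℕ → ℕ → ℕ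

/-- `reg r := x`. -/
def RAMState.setReg (s : RAMState) (r x : ℕ) : RAMState :=
  { s with reg := Function.update s.reg r x }

/-- `arr A i := x`. -/
def RAMState.setArr (s : RAMState) (A i x : ℕ) : RAMState :=
  { s with arr := Function.update s.arr A (Function.update (s.arr A) i x) }

/-- RAM programs. In all constructors `r`, `a`, `b`, `i` are names of registers, `A` is the name of
an array and `c` is a numeral. -/
inductive RAMProg where
  | skip : RAMProg
  /-- `r := c` -/
  | const (r c : ℕ) : RAMProg
  /-- `r := a + b` -/
  | add (r a b : ℕ) : RAMProg
  /-- `r := a - b` (truncated) -/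
  | sub (r a b : ℕ) : RAMProg
  /-- `r := A[i]` -/
  | load (r A i : ℕ) : RAMProg
  /-- `A[i] := a` -/
  | store (A i a : ℕ) : RAMProg
  /-- `p; q` -/
  | seq (p q : RAMProg) : RAMProg
  /-- `if a < b then p else q` -/
  | ifLt (a b : ℕ) (p q : RAMProg) : RAMProg
  /-- `while a < b do p` -/
  | whileLt (a b : ℕ) (p : RAMProg) : RAMProg

/-- `RAMExec p s t s'`: started in state `s`, the program `p` halts after exactly `t` steps, in
state `s'`. Every elementary instruction and every evaluation of a test is one step. -/
inductive RAMExec : RAMProg → RAMState → ℕ → RAMState → Prop where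
  | skip (s : RAMState) : RAMExec .skip s 1 s
  | const (s : RAMState) (r c : ℕ) : RAMExec (.const r c) s 1 (s.setReg r c)
  | add (s : RAMState) (r a b : ℕ) :
      RAMExec (.add r a b) s 1 (s.setReg r (s.reg a + s.reg b))
  | sub (s : RAMState) (r a b : ℕ) :
      RAMExec (.sub r a b) s 1 (s.setReg r (s.reg a - s.reg b))
  | load (s : RAMState) (r A i : ℕ) :
      RAMExec (.load r A i) s 1 (s.setReg r (s.arr A (s.reg i)))
  | store (s : RAMState) (A i a : ℕ) :
      RAMExec (.store A i a) s 1 (s.setArr A (s.reg i) (s.reg a))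
  | seq {p q : RAMProg} {s₁ s₂ s₃ : RAMState} {t₁ t₂ : ℕ} :
      RAMExec p s₁ t₁ s₂ → RAMExec q s₂ t₂ s₃ → RAMExec (.seq p q) s₁ (t₁ + t₂) s₃
  | ifTrue {a b : ℕ} {p q : RAMProg} {s s' : RAMState} {t : ℕ} :
      s.reg a < s.reg b → RAMExec p s t s' → RAMExec (.ifLt a b p q) s (t + 1) s'
  | ifFalse {a b : ℕ} {p q : RAMProg} {s s' : RAMState} {t : ℕ} :
      ¬ s.reg a < s.reg b → RAMExec q s t s' → RAMExec (.ifLt a b p q) s (t + 1) s'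
  | whileTrue {a b : ℕ} {p : RAMProg} {s₁ s₂ s₃ : RAMState} {t₁ t₂ : ℕ} :
      s₁.reg a < s₁.reg b → RAMExec p s₁ t₁ s₂ → RAMExec (.whileLt a b p) s₂ t₂ s₃ →
      RAMExec (.whileLt a b p) s₁ (t₁ + t₂ + 1) s₃
  | whileFalse {a b : ℕ} {p : RAMProg} {s : RAMState} :
      ¬ s.reg a < s.reg b → RAMExec (.whileLt a b p) s 1 s

/-- The initial state on the input word `w`: array `0` holds `w`, and everything else is `0`. -/
def RAMState.init (w : List ℕ) : RAMState where
  reg := fun _ => 0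
  arr := fun A i => if A = 0 then w.getD i 0 else 0

/-- The output word is read off from array `1`. -/
def RAMState.Outputs (s : RAMState) (w : List ℕ) : Prop :=
  ∀ i, ∀ hi : i < w.length, s.arr 1 i = w[i]

/-! ### Instances as words -/

/-- `w` is an encoding of the instance `(G, k)`: the number of vertices, `k`, the number of edges,
and then the two ends of each edge; every edge is listed exactly once, in any order and
with its ends in any order. -/
def EncodesInstance {n : ℕ} (G : SimpleGraph (Fin n)) (k : ℕ) (w : List ℕ) : Prop :=
  ∃ l : List (Fin n × Fin n),
    (l.map fun e => s(e.1, e.2)).Nodup ∧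
    (∀ e : Sym2 (Fin n), e ∈ G.edgeSet ↔ e ∈ l.map fun e => s(e.1, e.2)) ∧
    w = n :: k :: l.length :: l.flatMap fun e => [(e.1 : ℕ), (e.2 : ℕ)]

/-! ### Kernelization -/

/-- The program `P` is a kernelization algorithm for dominating set, parameterized by the
solution size, on `d`-degenerate graphs: on an instance `(G, k)` with `k ≥ 1` and `G` a
`d`-degenerate graph on `n` vertices, it halts after at most `time n` steps with an equivalent
instance `(G', k')`, where `G'` is `d`-degenerate and has at most `size k` vertices and at most
`size k` edges, and `k' ≤ param k`. -/
def IsDominatingSetKernelization (d : ℕ) (P : RAMProg) (time size param : ℕ → ℕ) : Prop :=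
  ∀ (n : ℕ) (G : SimpleGraph (Fin n)) (k : ℕ) (w : List ℕ),
    IsDegenerate G d → 1 ≤ k → EncodesInstance G k w →
    ∃ (t : ℕ) (s : RAMState), RAMExec P (RAMState.init w) t s ∧ t ≤ time n ∧
      ∃ (n' : ℕ) (G' : SimpleGraph (Fin n')) (k' : ℕ) (w' : List ℕ),
        EncodesInstance G' k' w' ∧ s.Outputs w' ∧
        IsDegenerate G' d ∧ n' ≤ size k ∧ G'.edgeSet.ncard ≤ size k ∧ k' ≤ param k ∧
        (HasDominatingSet G k ↔ HasDominatingSet G' k')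

/-! ### Timed Hoare triples for RAM programs -/

notation:60 p:61 ";;" q:60 => RAMProg.seq p q

namespace RAMState

@[simp] theorem setReg_reg (s : RAMState) (r x r' : ℕ) :
    (s.setReg r x).reg r' = if r' = r then x else s.reg r' := by
  simp [setReg, Function.update_apply]

@[simp] theorem setReg_arr (s : RAMState) (r x : ℕ) : (s.setReg r x).arr = s.arr := rfl

@[simp] theorem setArr_reg (s : RAMState) (A i x : ℕ) : (s.setArr A i x).reg = s.reg := rfl

@[simp] theorem setArr_arr_self (s : RAMState) (A i x j : ℕ) :
    (s.setArr A i x).arr A j = if j = i then x else s.arr A j := by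
  simp [setArr, Function.update_apply]

@[simp] theorem setArr_arr_of_ne (s : RAMState) {A B : ℕ} (i x : ℕ) (h : B ≠ A) :
    (s.setArr A i x).arr B = s.arr B := by
  simp [setArr, h]

end RAMState

namespace RAMProg

/-- Does the program contain an instruction that writes to the register `r`? -/
@[simp] def writesReg : RAMProg → ℕ → Bool
  | skip, _ => false
  | const r _, r' => r == r'
  | add r _ _, r' => r == r'
  | sub r _ _, r' => r == r'
  | load r _ _, r' => r == r'
  | store _ _ _, _ => false
  | seq p q, r' => p.writesReg r' || q.writesReg r'
  | ifLt _ _ p q, r' => p.writesReg r' || q.writesReg r'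
  | whileLt _ _ p, r' => p.writesReg r'

/-- Does the program contain an instruction that writes to the array `A`? -/
@[simp] def writesArr : RAMProg → ℕ → Bool
  | store A _ _, A' => A == A'
  | seq p q, A' => p.writesArr A' || q.writesArr A'
  | ifLt _ _ p q, A' => p.writesArr A' || q.writesArr A'
  | whileLt _ _ p, A' => p.writesArr A'
  | _, _ => false

/-- The program has no `while`. -/
@[simp] def loopFree : RAMProg → Bool
  | seq p q => p.loopFree && q.loopFree
  | ifLt _ _ p q => p.loopFree && q.loopFree
  | whileLt _ _ _ => false
  | _ => true

/-- The final state of a loop-free program. -/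
@[simp] def run : RAMProg → RAMState → RAMState
  | skip, s => s
  | const r c, s => s.setReg r c
  | add r a b, s => s.setReg r (s.reg a + s.reg b)
  | sub r a b, s => s.setReg r (s.reg a - s.reg b)
  | load r A i, s => s.setReg r (s.arr A (s.reg i))
  | store A i a, s => s.setArr A (s.reg i) (s.reg a)
  | seq p q, s => q.run (p.run s)
  | ifLt a b p q, s => if s.reg a < s.reg b then p.run s else q.run s
  | whileLt _ _ _, s => s

/-- A bound on the number of steps of a loop-free program. -/
@[simp] def cost : RAMProg → ℕ
  | seq p q => p.cost + q.cost
  | ifLt _ _ p q => max p.cost q.cost + 1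
  | _ => 1

/-- The states `s` and `s'` differ only in places that `p` may write to. -/
structure Frame (p : RAMProg) (s s' : RAMState) : Prop where
  reg : ∀ r, p.writesReg r = false → s'.reg r = s.reg r
  arr : ∀ A, p.writesArr A = false → s'.arr A = s.arr A

theorem Frame.refl (p : RAMProg) (s : RAMState) : p.Frame s s := ⟨fun _ _ => rfl, fun _ _ => rfl⟩

theorem Frame.trans {p : RAMProg} {s₁ s₂ s₃ : RAMState} (h : p.Frame s₁ s₂) (h' : p.Frame s₂ s₃) :
    p.Frame s₁ s₃ :=
  ⟨fun r hr => (h'.reg r hr).trans (h.reg r hr), fun A hA => (h'.arr A hA).trans (h.arr A hA)⟩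

theorem Frame.mono {p q : RAMProg} {s s' : RAMState} (h : p.Frame s s')
    (hr : ∀ r, q.writesReg r = false → p.writesReg r = false)
    (ha : ∀ A, q.writesArr A = false → p.writesArr A = false) : q.Frame s s' :=
  ⟨fun r hq => h.reg r (hr r hq), fun A hq => h.arr A (ha A hq)⟩

theorem Frame.seq_left {p q : RAMProg} {s s' : RAMState} (h : p.Frame s s') :
    (p ;; q).Frame s s' :=
  h.mono (by simp +contextual) (by simp +contextual)

theorem Frame.seq_right {p q : RAMProg} {s s' : RAMState} (h : q.Frame s s') :
    (p ;; q).Frame s s' :=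
  h.mono (by simp +contextual) (by simp +contextual)

theorem frame_of_exec {p : RAMProg} {s s' : RAMState} {t : ℕ} (h : RAMExec p s t s') :
    p.Frame s s' := by
  induction h with
  | skip | whileFalse => exact Frame.refl _ _
  | const | add | sub | load =>
    refine ⟨fun r hr => ?_, fun A _ => rfl⟩
    simp only [writesReg, beq_eq_false_iff_ne] at hr
    simp [Ne.symm hr]
  | store =>
    refine ⟨fun r hr => rfl, fun B hB => ?_⟩
    simp only [writesArr, beq_eq_false_iff_ne] at hB
    exact RAMState.setArr_arr_of_ne _ _ _ (Ne.symm hB)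
  | seq _ _ ih₁ ih₂ => exact ih₁.seq_left.trans ih₂.seq_right
  | ifTrue _ _ ih | ifFalse _ _ ih =>
    exact ih.mono (by simp +contextual) (by simp +contextual)
  | whileTrue _ _ _ ih₁ ih₂ =>
    exact Frame.trans (ih₁.mono (fun _ h => h) (fun _ h => h)) ih₂

/-- Started in `s`, the program halts within `T` steps in a state that satisfies `Q`. -/
def Runs (p : RAMProg) (s : RAMState) (T : ℕ) (Q : RAMState → Prop) : Prop :=
  ∃ t s', RAMExec p s t s' ∧ t ≤ T ∧ Q s'

theorem Runs.mono {p : RAMProg} {s : RAMState} {T T' : ℕ} {Q Q' : RAMState → Prop}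
    (h : p.Runs s T Q) (hT : T ≤ T') (hQ : ∀ s', p.Frame s s' → Q s' → Q' s') :
    p.Runs s T' Q' := by
  obtain ⟨t, s', he, ht, hq⟩ := h
  exact ⟨t, s', he, ht.trans hT, hQ s' (frame_of_exec he) hq⟩

theorem Runs.seq {p q : RAMProg} {s : RAMState} {T₁ T₂ T : ℕ} {Q R : RAMState → Prop}
    (hp : p.Runs s T₁ R) (hq : ∀ s', p.Frame s s' → R s' → q.Runs s' T₂ Q) (hT : T₁ + T₂ ≤ T) :
    (p ;; q).Runs s T Q := by
  obtain ⟨t, s', he, ht, hr⟩ := hp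
  obtain ⟨t', s'', he', ht', hq'⟩ := hq s' (frame_of_exec he) hr
  exact ⟨t + t', s'', .seq he he', by omega, hq'⟩

theorem Runs.ifLt {p q : RAMProg} {a b : ℕ} {s : RAMState} {T : ℕ} {Q : RAMState → Prop}
    (hp : s.reg a < s.reg b → p.Runs s T Q) (hq : ¬ s.reg a < s.reg b → q.Runs s T Q) :
    (RAMProg.ifLt a b p q).Runs s (T + 1) Q := by
  by_cases h : s.reg a < s.reg b
  · obtain ⟨t, s', he, ht, hQ⟩ := hp h
    exact ⟨t + 1, s', .ifTrue h he, by omega, hQ⟩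
  · obtain ⟨t, s', he, ht, hQ⟩ := hq h
    exact ⟨t + 1, s', .ifFalse h he, by omega, hQ⟩

theorem exec_run {p : RAMProg} (hp : p.loopFree = true) (s : RAMState) :
    ∃ t ≤ p.cost, RAMExec p s t (p.run s) := by
  induction p generalizing s with
  | skip => exact ⟨1, le_rfl, .skip s⟩
  | const => exact ⟨1, le_rfl, .const s _ _⟩
  | add => exact ⟨1, le_rfl, .add s _ _ _⟩
  | sub => exact ⟨1, le_rfl, .sub s _ _ _⟩
  | load => exact ⟨1, le_rfl, .load s _ _ _⟩
  | store => exact ⟨1, le_rfl, .store s _ _ _⟩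
  | seq p q ihp ihq =>
    simp only [loopFree, Bool.and_eq_true] at hp
    obtain ⟨t, ht, he⟩ := ihp hp.1 s
    obtain ⟨t', ht', he'⟩ := ihq hp.2 (p.run s)
    exact ⟨t + t', by simp only [cost]; omega, .seq he he'⟩
  | ifLt a b p q ihp ihq =>
    simp only [loopFree, Bool.and_eq_true] at hp
    by_cases h : s.reg a < s.reg b
    · obtain ⟨t, ht, he⟩ := ihp hp.1 s
      refine ⟨t + 1, by simp only [cost]; omega, ?_⟩
      simpa [h] using RAMExec.ifTrue (q := q) h he
    · obtain ⟨t, ht, he⟩ := ihq hp.2 s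
      refine ⟨t + 1, by simp only [cost]; omega, ?_⟩
      simpa [h] using RAMExec.ifFalse (p := p) h he
  | whileLt => simp at hp

theorem frame_run {p : RAMProg} (hp : p.loopFree = true) (s : RAMState) : p.Frame s (p.run s) := by
  obtain ⟨t, -, he⟩ := exec_run hp s
  exact frame_of_exec he

theorem Runs.of_run {p : RAMProg} {s : RAMState} {T : ℕ} {Q : RAMState → Prop}
    (hp : p.loopFree = true) (hT : p.cost ≤ T) (hQ : Q (p.run s)) : p.Runs s T Q := by
  obtain ⟨t, ht, he⟩ := exec_run hp s
  exact ⟨t, _, he, ht.trans hT, hQ⟩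

/-- `for i in [0, N) do body`. Register `0` is used as scratch. -/
def forLoop (i N : ℕ) (body : RAMProg) : RAMProg :=
  .const i 0 ;; .whileLt i N (body ;; .const 0 1 ;; .add i i 0)

@[simp] theorem forLoop_writesReg (i N : ℕ) (body : RAMProg) (r : ℕ) :
    (forLoop i N body).writesReg r = (i == r || body.writesReg r || 0 == r) := by
  simp only [forLoop, writesReg]
  cases (i == r) <;> cases body.writesReg r <;> cases (0 == r) <;> rfl

@[simp] theorem forLoop_writesArr (i N : ℕ) (body : RAMProg) (A : ℕ) :
    (forLoop i N body).writesArr A = body.writesArr A := by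
  simp [forLoop]

theorem Runs.forLoop {i N : ℕ} {body : RAMProg} {s : RAMState} {T n T' : ℕ}
    {Q : RAMState → Prop} (I : ℕ → RAMState → Prop)
    (hn : s.reg N = n)
    (hi : body.writesReg i = false) (hN : body.writesReg N = false)
    (hNi : N ≠ i) (hi0 : i ≠ 0) (hN0 : N ≠ 0)
    (h0 : I 0 (s.setReg i 0))
    (step : ∀ j < n, ∀ s', s'.reg i = j → (RAMProg.forLoop i N body).Frame s s' → I j s' →
      body.Runs s' T (fun s'' => I (j + 1) ((s''.setReg 0 1).setReg i (j + 1))))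
    (hT : n * (T + 3) + 2 ≤ T')
    (hQ : ∀ s', (RAMProg.forLoop i N body).Frame s s' → I n s' → Q s') :
    (RAMProg.forLoop i N body).Runs s T' Q := by
  have key : ∀ m j, j + m = n → ∀ s', s'.reg i = j → (RAMProg.forLoop i N body).Frame s s' →
      I j s' → (RAMProg.whileLt i N (body ;; .const 0 1 ;; .add i i 0)).Runs s' (m * (T + 3) + 1)
        (fun s'' => (RAMProg.forLoop i N body).Frame s s'' ∧ I n s'') := by
    have hNf : (RAMProg.forLoop i N body).writesReg N = false := by
      simp [hN, hNi.symm, hN0.symm]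
    intro m
    induction m with
    | zero =>
      intro j hj s' hsi hf hI
      refine ⟨1, s', .whileFalse ?_, by omega, hf, by simpa [show n = j by omega] using hI⟩
      rw [hsi, hf.reg N hNf, hn]; omega
    | succ m ih =>
      intro j hj s' hsi hf hI
      obtain ⟨t, s₁, he, ht, hI₁⟩ := step j (by omega) s' hsi hf hI
      have hf₁ := frame_of_exec he
      have hs₁ : s₁.reg i = j := (hf₁.reg i hi).trans hsi
      obtain ⟨t₂, s₂, he₂, ht₂, hQ₂⟩ := ih (j + 1) (by omega) ((s₁.setReg 0 1).setReg i (j + 1))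
        (by simp)
        (by
          refine hf.trans ⟨fun r hr => ?_, fun A hA => ?_⟩
          · simp only [forLoop_writesReg, Bool.or_eq_false_iff, beq_eq_false_iff_ne] at hr
            simp [Ne.symm hr.1.1, Ne.symm hr.2, hf₁.reg r hr.1.2]
          · simp only [forLoop_writesArr] at hA
            simp [hf₁.arr A hA]) hI₁
      have hinc : RAMExec (.const 0 1 ;; .add i i 0) s₁ (1 + 1)
          ((s₁.setReg 0 1).setReg i (j + 1)) := by
        have := RAMExec.seq (RAMExec.const s₁ 0 1) (RAMExec.add (s₁.setReg 0 1) i i 0)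
        simpa [hi0, hs₁] using this
      refine ⟨_, s₂, .whileTrue ?_ (.seq he hinc) he₂, ?_, hQ₂⟩
      · rw [hsi, hf.reg N hNf, hn]; omega
      · nlinarith
  obtain ⟨t, s', he, ht, hf, hI⟩ := key n 0 (by omega) (s.setReg i 0) (by simp)
    ⟨fun r hr => by
      simp only [forLoop_writesReg, Bool.or_eq_false_iff, beq_eq_false_iff_ne] at hr
      simp [Ne.symm hr.1.1], fun A _ => rfl⟩ h0
  exact ⟨1 + t, s', .seq (.const s i 0) he, by omega, hQ s' hf hI⟩

end RAMProg

/-! ### Degeneracy of finite vertex sets -/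

open scoped Classical in
/-- Every nonempty subset of `W` contains a vertex with at most `d` neighbours in the subset. -/
def DegenerateOn {V : Type*} (H : SimpleGraph V) (W : Finset V) (d : ℕ) : Prop :=
  ∀ A ⊆ W, A.Nonempty → ∃ v ∈ A, (A.filter (H.Adj v)).card ≤ d

open scoped Classical in
theorem isDegenerate_iff {V : Type*} [Fintype V] (G : SimpleGraph V) (d : ℕ) :
    IsDegenerate G d ↔ DegenerateOn G Finset.univ d := by
  constructor
  · intro h A _ hA
    obtain ⟨v, hv, hd⟩ := h ((⊤ : G.Subgraph).induce (A : Set V)) (by simpa using hA)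
    refine ⟨v, by simpa using hv, ?_⟩
    have : (((⊤ : G.Subgraph).induce (A : Set V)).neighborSet v) =
        ((A.filter (G.Adj v) : Finset V) : Set V) := by
      ext u
      have : v ∈ A := by simpa using hv
      simp [this]
    rw [this, Set.encard_coe_eq_coe_finsetCard] at hd
    exact_mod_cast hd
  · intro h H hH
    obtain ⟨v, hv, hd⟩ := h H.verts.toFinset (Finset.subset_univ _) (by simpa using hH)
    refine ⟨v, by simpa using hv, ?_⟩
    calc (H.neighborSet v).encard
        ≤ ((H.verts.toFinset.filter (G.Adj v) : Finset V) : Set V).encard := by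
          refine Set.encard_le_encard fun u hu => ?_
          have hu : H.Adj v u := hu
          simpa using ⟨hu.snd_mem, hu.adj_sub⟩
      _ ≤ d := by
          rw [Set.encard_coe_eq_coe_finsetCard]
          exact_mod_cast hd

theorem DegenerateOn.mono {V : Type*} {H : SimpleGraph V} {W W' : Finset V} {d : ℕ}
    (h : DegenerateOn H W d) (hW : W' ⊆ W) : DegenerateOn H W' d :=
  fun A hA => h A (hA.trans hW)

open scoped Classical in
theorem DegenerateOn.comap {V U : Type*} [Fintype U] {H : SimpleGraph V} {W : Finset V} {d : ℕ}
    (h : DegenerateOn H W d) (f : U ↪ V) (hf : ∀ u, f u ∈ W) :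
    DegenerateOn (H.comap f) Finset.univ d := by
  intro A _ hA
  obtain ⟨v, hv, hd⟩ := h (A.map f) (fun x hx => by
    obtain ⟨u, -, rfl⟩ := Finset.mem_map.1 hx; exact hf u) (by simpa using hA)
  obtain ⟨u, hu, rfl⟩ := Finset.mem_map.1 hv
  refine ⟨u, hu, ?_⟩
  rwa [Finset.filter_map, Finset.card_map] at hd

open scoped Classical in
/-- The number of arcs inside a vertex set. -/
theorem DegenerateOn.card_arcs_le {V : Type*} {H : SimpleGraph V} {W : Finset V} {d : ℕ}
    (h : DegenerateOn H W d) : ∑ v ∈ W, (W.filter (H.Adj v)).card ≤ 2 * d * W.card := by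
  induction hc : W.card generalizing W with
  | zero => simp [Finset.card_eq_zero.1 hc]
  | succ c ih =>
    obtain ⟨v, hv, hd⟩ := h W subset_rfl (Finset.card_pos.1 (by omega))
    have hvn : v ∉ W.erase v := Finset.notMem_erase v W
    have hW : insert v (W.erase v) = W := Finset.insert_erase hv
    have h1 := ih (h.mono (Finset.erase_subset v W)) (by rw [Finset.card_erase_of_mem hv]; omega)
    have h2 : ∀ u ∈ W.erase v, (W.filter (H.Adj u)).card =
        ((W.erase v).filter (H.Adj u)).card + if H.Adj v u then 1 else 0 := by
      intro u _
      conv_lhs => rw [← hW, Finset.filter_insert]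
      split_ifs with h1 h2 h2
      · rw [Finset.card_insert_of_notMem (by simp)]
      · exact absurd h1.symm h2
      · exact absurd h2.symm h1
      · rfl
    have h3 : ∑ u ∈ W.erase v, (if H.Adj v u then 1 else 0) = (W.filter (H.Adj v)).card := by
      rw [← Finset.card_filter]
      congr 1
      ext u
      simp only [Finset.mem_filter, Finset.mem_erase]
      exact ⟨fun h => ⟨h.1.2, h.2⟩, fun h => ⟨⟨h.2.ne', h.1⟩, h.2⟩⟩
    rw [← Finset.add_sum_erase W _ hv, Finset.sum_congr rfl h2, Finset.sum_add_distrib, h3]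
    nlinarith

open scoped Classical in
/-- Few vertices have more than `d` neighbours in a given set. -/
theorem DegenerateOn.card_highDegree_le {V : Type*} {H : SimpleGraph V} {W B X : Finset V} {d : ℕ}
    (h : DegenerateOn H W d) (hB : B ⊆ W) (hX : X ⊆ W) (hd : Disjoint B X)
    (hdeg : ∀ x ∈ X, d < (B.filter (H.Adj x)).card) : X.card ≤ d * B.card := by
  have h1 := (h.mono (Finset.union_subset hB hX)).card_arcs_le
  rw [Finset.sum_union hd, Finset.card_union_of_disjoint hd] at h1
  have h2 : (d + 1) * X.card ≤ ∑ x ∈ X, (B.filter (H.Adj x)).card := by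
    rw [mul_comm, ← smul_eq_mul]
    exact Finset.card_nsmul_le_sum _ _ _ hdeg
  have h3 : ∑ x ∈ X, (B.filter (H.Adj x)).card = ∑ b ∈ B, (X.filter (H.Adj b)).card := by
    have := Finset.sum_card_bipartiteAbove_eq_sum_card_bipartiteBelow (s := X) (t := B)
      (r := fun x b => H.Adj x b)
    simpa [Finset.bipartiteAbove, Finset.bipartiteBelow, H.adj_comm] using this
  have h4 : ∑ b ∈ B, (X.filter (H.Adj b)).card ≤ ∑ b ∈ B, ((B ∪ X).filter (H.Adj b)).card :=
    Finset.sum_le_sum fun b _ => Finset.card_le_card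
      (Finset.filter_subset_filter _ Finset.subset_union_right)
  have h5 : ∑ x ∈ X, (B.filter (H.Adj x)).card ≤ ∑ x ∈ X, ((B ∪ X).filter (H.Adj x)).card :=
    Finset.sum_le_sum fun b _ => Finset.card_le_card
      (Finset.filter_subset_filter _ Finset.subset_union_left)
  nlinarith

theorem IsDegenerate.ncard_edgeSet_le {n d : ℕ} {G : SimpleGraph (Fin n)} (h : IsDegenerate G d) :
    G.edgeSet.ncard ≤ d * n := by
  classical
  have h1 := ((isDegenerate_iff G d).1 h).card_arcs_le
  have h2 := G.sum_degrees_eq_twice_card_edges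
  have h3 : ∀ v, G.degree v = (Finset.univ.filter (G.Adj v)).card := fun v => by
    rw [← G.card_neighborFinset_eq_degree, G.neighborFinset_eq_filter]
  simp only [h3] at h2
  have h4 : G.edgeSet.ncard = G.edgeFinset.card := by
    rw [← SimpleGraph.coe_edgeFinset, Set.ncard_coe_finset]
  rw [h4]
  simp only [Finset.card_univ, Fintype.card_fin] at h1
  have h5 : 2 * G.edgeFinset.card ≤ 2 * d * n := by
    rw [← h2]
    convert h1
  nlinarith

/-! ### The kernel -/

/-- `D` dominates all vertices of `B`. -/
def DominatesOn {V : Type*} (H : SimpleGraph V) (D B : Finset V) : Prop :=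
  ∀ u ∈ B, u ∈ D ∨ ∃ v ∈ D, H.Adj u v

/-- `W` contains at most `k` vertices that dominate `W`. -/
def HasDominatingSetOn {V : Type*} (H : SimpleGraph V) (W : Finset V) (k : ℕ) : Prop :=
  ∃ D ⊆ W, D.card ≤ k ∧ DominatesOn H D W

theorem hasDominatingSet_comap_iff {V U : Type*} [Fintype U] (H : SimpleGraph V) (W : Finset V)
    (f : U ↪ V) (hf : ∀ v, v ∈ W ↔ ∃ u, f u = v) (k : ℕ) :
    HasDominatingSet (H.comap f) k ↔ HasDominatingSetOn H W k := by
  classical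
  constructor
  · rintro ⟨S, hS, hdom⟩
    refine ⟨S.map f, fun x hx => ?_, by simpa using hS, fun x hx => ?_⟩
    · obtain ⟨u, -, rfl⟩ := Finset.mem_map.1 hx
      exact (hf _).2 ⟨u, rfl⟩
    · obtain ⟨u, rfl⟩ := (hf x).1 hx
      by_cases hu : u ∈ S
      · exact Or.inl (by simpa using hu)
      · obtain ⟨v, hv, hadj⟩ := hdom u hu
        exact Or.inr ⟨f v, by simpa using hv, hadj⟩
  · rintro ⟨D, hDW, hD, hdom⟩
    refine ⟨D.preimage f f.injective.injOn, ?_, fun u hu => ?_⟩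
    · refine le_trans ?_ hD
      rw [← Finset.card_map f]
      exact Finset.card_le_card fun x hx => by
        obtain ⟨u, hu, rfl⟩ := Finset.mem_map.1 hx
        simpa using hu
    · rcases hdom (f u) ((hf _).2 ⟨u, rfl⟩) with h | ⟨v, hv, hadj⟩
      · exact absurd (by simpa using h) hu
      · obtain ⟨v', rfl⟩ := (hf v).1 (hDW hv)
        exact ⟨v', by simpa using hv, hadj⟩

/-- A set of `s` vertices that are common out-neighbours of `capSeq k d (d + 1 - s)` blue vertices
meets every solution of size at most `k`. -/
def capSeq (k d : ℕ) : ℕ → ℕ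
  | 0 => 0
  | j + 1 => k * (capSeq k d j + d + 1) + 1

theorem capSeq_le {k : ℕ} (hk : 1 ≤ k) (d j : ℕ) : capSeq k d j ≤ (d + 2) * (j * k ^ j) := by
  induction j with
  | zero => simp [capSeq]
  | succ j ih =>
    have h1 : 1 ≤ k ^ j := Nat.one_le_pow _ _ hk
    calc k * (capSeq k d j + d + 1) + 1 ≤ k * (capSeq k d j + (d + 2)) := by nlinarith
      _ ≤ k * ((d + 2) * (j * k ^ j) + (d + 2) * k ^ j) := by
          gcongr
          nlinarith
      _ = (d + 2) * ((j + 1) * k ^ (j + 1)) := by ring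

open scoped Classical in
/-- The neighbours of `x` among the vertices below `n` that have a smaller rank. -/
noncomputable def outNbrs (H : SimpleGraph ℕ) (n : ℕ) (pos : ℕ → ℕ) (x : ℕ) : Finset ℕ :=
  (Finset.range n).filter fun y => H.Adj x y ∧ pos y < pos x

/-- The vertices of `B` that have all of `Y` among their out-neighbours. -/
noncomputable def above (H : SimpleGraph ℕ) (n : ℕ) (pos : ℕ → ℕ) (B Y : Finset ℕ) : Finset ℕ :=
  B.filter fun u => Y ⊆ outNbrs H n pos u

/-- `pos` ranks the vertices below `n` such that each has at most `d` out-neighbours. -/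
structure IsRanking (H : SimpleGraph ℕ) (n d : ℕ) (pos : ℕ → ℕ) : Prop where
  inj : ∀ u < n, ∀ v < n, pos u = pos v → u = v
  card_le : ∀ v < n, (outNbrs H n pos v).card ≤ d

/-- Every set has at most the allowed number of blue vertices above it. -/
def Sparse (H : SimpleGraph ℕ) (n d k : ℕ) (pos : ℕ → ℕ) (B : Finset ℕ) : Prop :=
  ∀ Y, (above H n pos B Y).card ≤ capSeq k d (d + 1 - Y.card)

/-- Some subset of the out-neighbours of `w` has the allowed number of blue vertices above it. -/
def Saturated (H : SimpleGraph ℕ) (n d k : ℕ) (pos : ℕ → ℕ) (B : Finset ℕ) (w : ℕ) : Prop :=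
  ∃ Y ⊆ outNbrs H n pos w, capSeq k d (d + 1 - Y.card) ≤ (above H n pos B Y).card

theorem Saturated.mono {H : SimpleGraph ℕ} {n d k : ℕ} {pos : ℕ → ℕ} {B B' : Finset ℕ} {w : ℕ}
    (h : Saturated H n d k pos B w) (hB : B ⊆ B') : Saturated H n d k pos B' w := by
  obtain ⟨Y, hY, hc⟩ := h
  exact ⟨Y, hY, hc.trans (Finset.card_le_card (Finset.filter_subset_filter _ hB))⟩

theorem Sparse.insert {H : SimpleGraph ℕ} {n d k : ℕ} {pos : ℕ → ℕ} {B : Finset ℕ} {w : ℕ}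
    (h : Sparse H n d k pos B) (hw : ¬ Saturated H n d k pos B w) :
    Sparse H n d k pos (insert w B) := by
  intro Y
  unfold above
  rw [Finset.filter_insert]
  split_ifs with hY
  · refine (Finset.card_insert_le _ _).trans ?_
    by_contra hc
    exact hw ⟨Y, hY, by unfold above; omega⟩
  · exact h Y

theorem exists_mem_of_full {H : SimpleGraph ℕ} {n d k : ℕ} {pos : ℕ → ℕ} {B D Y : Finset ℕ}
    (hH : ∀ x y, H.Adj x y → x < n ∧ y < n) (hpos : IsRanking H n d pos)
    (hsp : Sparse H n d k pos B)
    (hD : D.card ≤ k) (hdom : DominatesOn H D B) (hDn : D ⊆ Finset.range n)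
    (hY : Y.card ≤ d) (hfull : capSeq k d (d + 1 - Y.card) ≤ (above H n pos B Y).card) :
    ∃ y ∈ Y, y ∈ D := by
  by_contra! hno
  have hsub : above H n pos B Y ⊆
      D.biUnion fun x => {x} ∪ outNbrs H n pos x ∪ above H n pos B (insert x Y) := by
    intro v hv
    obtain ⟨hvB, hYv⟩ := Finset.mem_filter.1 hv
    rw [Finset.mem_biUnion]
    rcases hdom v hvB with h | ⟨x, hx, hadj⟩
    · exact ⟨v, h, by simp⟩
    · refine ⟨x, hx, ?_⟩
      obtain ⟨hvn, hxn⟩ := hH v x hadj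
      simp only [Finset.mem_union]
      rcases lt_trichotomy (pos x) (pos v) with h | h | h
      · refine Or.inr (Finset.mem_filter.2 ⟨hvB, Finset.insert_subset ?_ hYv⟩)
        simp [outNbrs, hxn, hadj, h]
      · exact absurd (hpos.inj _ hxn _ hvn h) hadj.ne'
      · exact Or.inl (Or.inr (by simp [outNbrs, hvn, hadj.symm, h]))
  have h1 := (Finset.card_le_card hsub).trans (Finset.card_biUnion_le_card_mul D _
    (capSeq k d (d - Y.card) + d + 1) (fun x hx => by
      have h2 := hsp (insert x Y)
      rw [Finset.card_insert_of_notMem (fun h => hno x h hx),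
        show d + 1 - (Y.card + 1) = d - Y.card by omega] at h2
      have h3 := hpos.card_le x (by simpa using hDn hx)
      have h4 := Finset.card_union_le ({x} ∪ outNbrs H n pos x) (above H n pos B (insert x Y))
      have h5 := Finset.card_union_le {x} (outNbrs H n pos x)
      rw [Finset.card_singleton] at h5
      omega))
  rw [show d + 1 - Y.card = (d - Y.card) + 1 by omega, capSeq] at hfull
  have := Nat.mul_le_mul_right (capSeq k d (d - Y.card) + d + 1) hD
  omega

open scoped Classical in
/-- The blue vertices together with the white vertices whose blue neighbourhood is not contained in
that of a smaller vertex. -/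
noncomputable def retained (H : SimpleGraph ℕ) (n : ℕ) (B : Finset ℕ) : Finset ℕ :=
  (Finset.range n).filter fun w =>
    w ∈ B ∨ ∀ w' < w, ¬ B.filter (H.Adj w) ⊆ B.filter (H.Adj w')

open scoped Classical in
theorem exists_retained {H : SimpleGraph ℕ} {n : ℕ} {B : Finset ℕ} (w : ℕ) (hw : w < n) :
    ∃ r ∈ retained H n B, (w ∈ B → r = w) ∧ B.filter (H.Adj w) ⊆ B.filter (H.Adj r) := by
  induction w using Nat.strong_induction_on with
  | _ w ih =>
    by_cases h : w ∈ retained H n B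
    · exact ⟨w, h, fun _ => rfl, subset_rfl⟩
    · have h' := h
      simp only [retained, Finset.mem_filter, Finset.mem_range, hw, true_and, not_or,
        not_forall, not_not, exists_prop] at h'
      obtain ⟨hB, w', hlt, hsub⟩ := h'
      obtain ⟨r, hr, -, hr'⟩ := ih w' hlt (hlt.trans hw)
      exact ⟨r, hr, fun h => absurd h hB, hsub.trans hr'⟩

theorem hasDominatingSetOn_retained_iff {H : SimpleGraph ℕ} {n d k : ℕ} {pos : ℕ → ℕ}
    {B : Finset ℕ} (hH : ∀ x y, H.Adj x y → x < n ∧ y < n) (hpos : IsRanking H n d pos)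
    (hB : B ⊆ Finset.range n) (hsp : Sparse H n d k pos B)
    (hsat : ∀ w < n, w ∉ B → Saturated H n d k pos B w) :
    HasDominatingSetOn H (Finset.range n) k ↔ HasDominatingSetOn H (retained H n B) k := by
  classical
  have hRn : retained H n B ⊆ Finset.range n := Finset.filter_subset _ _
  have hBR : B ⊆ retained H n B := fun x hx =>
    Finset.mem_filter.2 ⟨hB hx, Or.inl hx⟩
  have key : ∀ D ⊆ Finset.range n, D.card ≤ k → DominatesOn H D B →
      DominatesOn H D (Finset.range n) := by
    intro D hDn hD hdom w hw
    by_cases hwB : w ∈ B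
    · exact hdom w hwB
    · rw [Finset.mem_range] at hw
      obtain ⟨Y, hY, hc⟩ := hsat w hw hwB
      obtain ⟨y, hy, hyD⟩ := exists_mem_of_full hH hpos hsp hD hdom hDn
        ((Finset.card_le_card hY).trans (hpos.card_le w hw)) hc
      exact Or.inr ⟨y, hyD, (Finset.mem_filter.1 (hY hy)).2.1⟩
  constructor
  · rintro ⟨D, hDn, hD, hdom⟩
    have hrep : ∀ w, ∃ r, w < n → r ∈ retained H n B ∧ (w ∈ B → r = w) ∧
        B.filter (H.Adj w) ⊆ B.filter (H.Adj r) := fun w => by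
      by_cases hw : w < n
      · obtain ⟨r, hr⟩ := exists_retained (H := H) (B := B) w hw
        exact ⟨r, fun _ => hr⟩
      · exact ⟨0, fun h => absurd h hw⟩
    choose rep hrep using hrep
    have hsub : D.image rep ⊆ retained H n B := fun x hx => by
      obtain ⟨w, hw, rfl⟩ := Finset.mem_image.1 hx
      exact (hrep w (by simpa using hDn hw)).1
    have hcard : (D.image rep).card ≤ k := Finset.card_image_le.trans hD
    refine ⟨D.image rep, hsub, hcard, fun u hu => ?_⟩
    refine key _ (hsub.trans hRn) hcard (fun u hu => ?_) u (hRn hu)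
    rcases hdom u (hB hu) with h | ⟨v, hv, hadj⟩
    · left
      have := (hrep u (by simpa using hB hu)).2.1 hu
      exact Finset.mem_image.2 ⟨u, h, this⟩
    · right
      have := (hrep v (by simpa using hDn hv)).2.2 (Finset.mem_filter.2 ⟨hu, hadj.symm⟩)
      exact ⟨rep v, Finset.mem_image_of_mem _ hv, (Finset.mem_filter.1 this).2.symm⟩
  · rintro ⟨D, hDR, hD, hdom⟩
    exact ⟨D, hDR.trans hRn, hD, key D (hDR.trans hRn) hD fun u hu => hdom u (hBR hu)⟩

theorem card_filter_card_le_powerset {V : Type*} (B : Finset V) (d : ℕ) :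
    (B.powerset.filter fun X => X.card ≤ d).card ≤ (d + 1) * (max B.card 1) ^ d := by
  classical
  have : (B.powerset.filter fun X => X.card ≤ d) ⊆
      (Finset.range (d + 1)).biUnion fun i => B.powersetCard i := by
    intro X hX
    obtain ⟨h1, h2⟩ := Finset.mem_filter.1 hX
    exact Finset.mem_biUnion.2 ⟨X.card, Finset.mem_range.2 (by omega),
      Finset.mem_powersetCard.2 ⟨Finset.mem_powerset.1 h1, rfl⟩⟩
  refine (Finset.card_le_card this).trans ?_
  refine (Finset.card_biUnion_le_card_mul _ _ ((max B.card 1) ^ d) fun i hi => ?_).trans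
    (by rw [Finset.card_range])
  rw [Finset.card_powersetCard]
  calc B.card.choose i ≤ B.card ^ i := Nat.choose_le_pow _ _
    _ ≤ (max B.card 1) ^ i := Nat.pow_le_pow_left (le_max_left _ _) _
    _ ≤ (max B.card 1) ^ d :=
      Nat.pow_le_pow_right (by omega) (by have := Finset.mem_range.1 hi; omega)

theorem card_retained_le {H : SimpleGraph ℕ} {n d : ℕ} {B : Finset ℕ}
    (hdeg : DegenerateOn H (Finset.range n) d) (hB : B ⊆ Finset.range n) :
    (retained H n B).card ≤ B.card + d * B.card + (d + 1) * (max B.card 1) ^ d := by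
  classical
  set R := retained H n B
  have hRn : R ⊆ Finset.range n := Finset.filter_subset _ _
  set X := (R \ B).filter fun w => d < (B.filter (H.Adj w)).card with hX
  set Z := (R \ B).filter fun w => ¬ d < (B.filter (H.Adj w)).card with hZ
  have h1 : X.card ≤ d * B.card := by
    refine hdeg.card_highDegree_le hB ?_ ?_ fun x hx => (Finset.mem_filter.1 hx).2
    · exact (Finset.filter_subset _ _).trans (Finset.sdiff_subset.trans hRn)
    · exact Finset.disjoint_of_subset_right (Finset.filter_subset _ _) Finset.disjoint_sdiff
  have h2 : Z.card ≤ (d + 1) * (max B.card 1) ^ d := by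
    refine le_trans ?_ (card_filter_card_le_powerset B d)
    refine Finset.card_le_card_of_injOn (fun w => B.filter (H.Adj w)) (fun w hw => ?_) ?_
    · have := (Finset.mem_filter.1 (Finset.mem_coe.1 hw)).2
      simp only [Finset.coe_filter, Finset.mem_powerset, Set.mem_ofPred_eq]
      exact ⟨Finset.filter_subset _ _, by omega⟩
    · have key : ∀ w ∈ Z, ∀ w' < w, B.filter (H.Adj w) ≠ B.filter (H.Adj w') := by
        intro w hw w' hlt heq
        have hw := Finset.mem_sdiff.1 (Finset.mem_filter.1 hw).1
        rcases (Finset.mem_filter.1 hw.1).2 with h | h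
        · exact hw.2 h
        · exact h w' hlt heq.subset
      intro a ha b hb hab
      rcases lt_trichotomy a b with h | h | h
      · exact absurd hab.symm (key b hb a h)
      · exact h
      · exact absurd hab (key a ha b h)
  have h3 : X.card + Z.card = (R \ B).card := Finset.card_filter_add_card_filter_not _
  have h4 : R.card ≤ (R \ B).card + B.card := Finset.card_le_card_sdiff_add_card
  omega

theorem kernel_size_le {d k b r : ℕ} (hd : 1 ≤ d) (hk : 1 ≤ k) (hb : b ≤ capSeq k d (d + 1))
    (hr : r ≤ b + d * b + (d + 1) * (max b 1) ^ d) :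
    d * r ≤ 2 * ((d + 2) ^ (2 * (d + 2)) * k ^ (2 * (d + 1) ^ 2)) ∧
      r ≤ 2 * ((d + 2) ^ (2 * (d + 2)) * k ^ (2 * (d + 1) ^ 2)) := by
  have h1 : max b 1 ≤ (d + 2) ^ 2 * k ^ (d + 1) := by
    have := (capSeq_le hk d (d + 1)).trans' hb
    have hk' : 1 ≤ k ^ (d + 1) := Nat.one_le_pow _ _ hk
    refine max_le (this.trans ?_) (Nat.mul_pos (by positivity) hk')
    rw [← mul_assoc]
    exact Nat.mul_le_mul_right _ (by nlinarith)
  have h2 : max b 1 ≤ (max b 1) ^ d := Nat.le_self_pow (by omega) _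
  have h3 : r ≤ 2 * (d + 1) * (max b 1) ^ d := by
    have : b ≤ (max b 1) ^ d := (le_max_left _ _).trans h2
    nlinarith
  have h4 : (max b 1) ^ d ≤ (d + 2) ^ (2 * d) * k ^ (2 * (d + 1) ^ 2) := by
    calc (max b 1) ^ d ≤ ((d + 2) ^ 2 * k ^ (d + 1)) ^ d := Nat.pow_le_pow_left h1 d
      _ = (d + 2) ^ (2 * d) * k ^ ((d + 1) * d) := by rw [mul_pow, ← pow_mul, ← pow_mul]
      _ ≤ _ := Nat.mul_le_mul_left _ (Nat.pow_le_pow_right hk (by nlinarith))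
  have h5 : d * r ≤ 2 * ((d + 2) ^ (2 * (d + 2)) * k ^ (2 * (d + 1) ^ 2)) := by
    calc d * r ≤ d * (2 * (d + 1) * ((d + 2) ^ (2 * d) * k ^ (2 * (d + 1) ^ 2))) :=
          Nat.mul_le_mul_left _ (h3.trans (Nat.mul_le_mul_left _ h4))
      _ = (2 * (d * (d + 1))) * ((d + 2) ^ (2 * d) * k ^ (2 * (d + 1) ^ 2)) := by ring
      _ ≤ (2 * (d + 2) ^ 4) * ((d + 2) ^ (2 * d) * k ^ (2 * (d + 1) ^ 2)) := by
          refine Nat.mul_le_mul_right _ (Nat.mul_le_mul_left _ ?_)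
          calc d * (d + 1) ≤ (d + 2) ^ 2 := by nlinarith
            _ ≤ (d + 2) ^ 4 := Nat.pow_le_pow_right (by omega) (by norm_num)
      _ = _ := by ring
  exact ⟨h5, (Nat.le_mul_of_pos_left r hd).trans h5⟩

/-! ### The registers and arrays of the kernelization program -/

notation "r_n" => (1 : ℕ)
notation "r_k" => (2 : ℕ)
notation "r_m" => (3 : ℕ)
notation "r_arcs" => (4 : ℕ)
notation "r_i" => (5 : ℕ)
notation "r_x" => (6 : ℕ)
notation "r_y" => (7 : ℕ)
notation "r_f" => (8 : ℕ)
notation "r_a" => (9 : ℕ)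
notation "r_b" => (10 : ℕ)
notation "r_v" => (11 : ℕ)
notation "r_cnt" => (12 : ℕ)
notation "r_size" => (13 : ℕ)
notation "r_flag" => (14 : ℕ)
notation "r_len" => (15 : ℕ)

notation "a_in" => (0 : ℕ)
notation "a_out" => (1 : ℕ)
notation "a_src" => (2 : ℕ)
notation "a_tgt" => (3 : ℕ)
notation "a_pos" => (4 : ℕ)
notation "a_hit" => (5 : ℕ)
notation "a_mark" => (6 : ℕ)
notation "a_list" => (7 : ℕ)
notation "a_col" => (8 : ℕ)
notation "a_cap" => (9 : ℕ)
notation "a_deg" => (10 : ℕ)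
notation "a_ret" => (11 : ℕ)
notation "a_id" => (12 : ℕ)

namespace RAMProg

/-- The arrays `S` and `T` list the arcs of `H`, each exactly once. -/
structure Arcs (H : SimpleGraph ℕ) (n M : ℕ) (S T : ℕ → ℕ) : Prop where
  lt : ∀ x y, H.Adj x y → x < n ∧ y < n
  adj_iff : ∀ x y, H.Adj x y ↔ ∃ i < M, S i = x ∧ T i = y
  inj : ∀ i < M, ∀ j < M, S i = S j → T i = T j → i = j

/-- The graph `H` on the vertices below `n` is stored in the state. -/
structure Stored (H : SimpleGraph ℕ) (n M : ℕ) (s : RAMState) : Prop where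
  n_eq : s.reg r_n = n
  M_eq : s.reg r_arcs = M
  arcs : Arcs H n M (s.arr a_src) (s.arr a_tgt)

theorem Stored.of_frame {H : SimpleGraph ℕ} {n M : ℕ} {s s' : RAMState} {p : RAMProg}
    (h : Stored H n M s) (hf : p.Frame s s') (h1 : p.writesReg r_n = false := by rfl)
    (h2 : p.writesReg r_arcs = false := by rfl) (h3 : p.writesArr a_src = false := by rfl)
    (h4 : p.writesArr a_tgt = false := by rfl) : Stored H n M s' :=
  ⟨(hf.reg _ h1).trans h.n_eq, (hf.reg _ h2).trans h.M_eq, by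
    rw [hf.arr _ h3, hf.arr _ h4]; exact h.arcs⟩

theorem Stored.of_eq {H : SimpleGraph ℕ} {n M : ℕ} {s s' : RAMState}
    (h : Stored H n M s) (h1 : s'.reg r_n = s.reg r_n) (h2 : s'.reg r_arcs = s.reg r_arcs)
    (h3 : s'.arr a_src = s.arr a_src) (h4 : s'.arr a_tgt = s.arr a_tgt) : Stored H n M s' :=
  ⟨h1.trans h.n_eq, h2.trans h.M_eq, by rw [h3, h4]; exact h.arcs⟩

/-- A loop-free program that only computes a value in the register `r_f`. -/
structure IsTest (test : RAMProg) : Prop where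
  loopFree : test.loopFree = true
  cost_le : test.cost ≤ 8
  reg : ∀ r, test.writesReg r = true → r = r_f ∨ r = r_a ∨ r = r_b
  arr : ∀ A, test.writesArr A = false

theorem IsTest.run_reg {test : RAMProg} (h : IsTest test) (s : RAMState) {r : ℕ}
    (h1 : r ≠ r_f) (h2 : r ≠ r_a) (h3 : r ≠ r_b) : (test.run s).reg r = s.reg r :=
  (frame_run h.loopFree s).reg r (by
    by_contra hr
    have := h.reg r (by simpa using hr)
    omega)

theorem IsTest.run_arr {test : RAMProg} (h : IsTest test) (s : RAMState) :
    (test.run s).arr = s.arr :=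
  funext fun A => (frame_run h.loopFree s).arr A (h.arr A)

theorem IsTest.writesReg {test : RAMProg} (h : IsTest test) {r : ℕ}
    (h1 : r ≠ r_f) (h2 : r ≠ r_a) (h3 : r ≠ r_b) : test.writesReg r = false := by
  by_contra hr
  have := h.reg r (by simpa using hr)
  omega

/-- `A[x] := #{y | x ~ y and test(x, y)}` for every vertex `x`. -/
def tally (A : ℕ) (test : RAMProg) : RAMProg :=
  forLoop r_i r_n (.const r_f 0 ;; .store A r_i r_f) ;;
  forLoop r_i r_arcs (.load r_x a_src r_i ;; .load r_y a_tgt r_i ;; test ;;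
    .load r_a A r_x ;; .add r_a r_a r_f ;; .store A r_x r_a)

open scoped Classical in
theorem Arcs.sum_eq {H : SimpleGraph ℕ} {n M : ℕ} {S T : ℕ → ℕ} (h : Arcs H n M S T)
    (P : ℕ → ℕ → Prop) (x : ℕ) :
    ∑ i ∈ Finset.range M, (if S i = x ∧ P x (T i) then 1 else 0) =
      ((Finset.range n).filter fun y => H.Adj x y ∧ P x y).card := by
  rw [← Finset.card_filter]
  refine Finset.card_bij (fun i _ => T i) ?_ ?_ ?_
  · intro i hi
    simp only [Finset.mem_filter, Finset.mem_range] at hi ⊢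
    have hadj : H.Adj x (T i) := (h.adj_iff _ _).2 ⟨i, hi.1, hi.2.1, rfl⟩
    exact ⟨(h.lt _ _ hadj).2, hadj, hi.2.2⟩
  · intro i hi j hj hij
    simp only [Finset.mem_filter, Finset.mem_range] at hi hj
    exact h.inj i hi.1 j hj.1 (hi.2.1.trans hj.2.1.symm) hij
  · intro y hy
    simp only [Finset.mem_filter, Finset.mem_range] at hy
    obtain ⟨i, hi, hS, hT⟩ := (h.adj_iff _ _).1 hy.2.1
    exact ⟨i, by simpa [hi, hS, hT] using hy.2.2, hT⟩

open scoped Classical in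
theorem tally_runs {H : SimpleGraph ℕ} {n M A : ℕ} {test : RAMProg} {s : RAMState}
    {P : ℕ → ℕ → Prop} (ht : IsTest test) (hs : Stored H n M s) (hA2 : A ≠ a_src) (hA3 : A ≠ a_tgt)
    (hP : ∀ s', (tally A test).Frame s s' → s'.reg r_x < n → s'.reg r_y < n →
      (test.run s').reg r_f = if P (s'.reg r_x) (s'.reg r_y) then 1 else 0) :
    (tally A test).Runs s (20 * (n + M + 1)) fun s' => ∀ x < n, s'.arr A x =
      ((Finset.range n).filter fun y => H.Adj x y ∧ P x y).card := by
  refine Runs.seq (T₁ := n * 5 + 2) (T₂ := M * 16 + 2) (R := fun s' => ∀ x < n, s'.arr A x = 0)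
    ?_ (fun s₁ hf₁ h₁ => ?_) (by omega)
  · refine Runs.forLoop (fun j s' => ∀ x < j, s'.arr A x = 0) (T := 2) hs.n_eq rfl rfl
      (by decide) (by decide) (by decide) (by simp) (fun j hj s' hj' hf hI => ?_) le_rfl
      (fun _ _ h => h)
    refine Runs.of_run rfl le_rfl fun x hx => ?_
    by_cases h : x = j
    · simp [h, hj']
    · simpa [h, hj'] using hI x (by omega)
  · have hs₁ : Stored H n M s₁ := hs.of_frame hf₁ rfl rfl (by simp [hA2]) (by simp [hA3])
    have hf₁' : (tally A test).Frame s s₁ := hf₁.seq_left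
    have w : ∀ r, r ≠ r_f → r ≠ r_a → r ≠ r_b → test.writesReg r = false :=
      fun r h1 h2 h3 => ht.writesReg h1 h2 h3
    refine Runs.forLoop (fun j s' => ∀ x < n, s'.arr A x =
      ∑ i ∈ Finset.range j, (if s.arr a_src i = x ∧ P x (s.arr a_tgt i) then 1 else 0)) (T := 13)
      hs₁.M_eq (by simp [w]) (by simp [w])
      (by decide) (by decide) (by decide) (by simpa using h₁) (fun j hj s' hj' hf hI => ?_) le_rfl
      (fun s' _ h x hx => by rw [h x hx, hs.arcs.sum_eq])
    refine Runs.of_run (by simp [ht.loopFree]) (by have := ht.cost_le; simp; omega) fun x hx => ?_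
    have hfs : (tally A test).Frame s s' := hf₁'.trans hf.seq_right
    have e2 : s'.arr a_src = s.arr a_src :=
      hfs.arr _ (by simp [tally, hA2, ht.arr])
    have e3 : s'.arr a_tgt = s.arr a_tgt :=
      hfs.arr _ (by simp [tally, hA3, ht.arr])
    set s₂ := (s'.setReg r_x (s.arr a_src j)).setReg r_y (s.arr a_tgt j) with hs₂
    have hfs₂ : (tally A test).Frame s s₂ := by
      refine hfs.trans ⟨fun r hr => ?_, fun B hB => rfl⟩
      simp only [tally, writesReg, forLoop_writesReg, Bool.or_eq_false_iff,
        beq_eq_false_iff_ne] at hr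
      simp [hs₂, Ne.symm hr.2.1.2.1, Ne.symm hr.2.1.2.2.1]
    have hadj : H.Adj (s.arr a_src j) (s.arr a_tgt j) :=
      (hs.arcs.adj_iff _ _).2 ⟨j, hj, rfl, rfl⟩
    have hlt := hs.arcs.lt _ _ hadj
    have hv := hP s₂ hfs₂ (by simpa [hs₂] using hlt.1) (by simpa [hs₂] using hlt.2)
    have hx₂ : (test.run s₂).reg r_x = s.arr a_src j := by
      rw [ht.run_reg _ (by decide) (by decide) (by decide)]; simp [hs₂]
    have ha₂ : (test.run s₂).arr A = s'.arr A := by rw [ht.run_arr]; simp [hs₂]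
    have hrun : ((s'.setReg r_x (s'.arr a_src (s'.reg r_i))).setReg r_y
        ((s'.setReg r_x (s'.arr a_src (s'.reg r_i))).arr a_tgt
          ((s'.setReg r_x (s'.arr a_src (s'.reg r_i))).reg r_i))) = s₂ := by
      simp [hs₂, hj', e2, e3]
    have hv' : (test.run s₂).reg r_f =
        if P (s.arr a_src j) (s.arr a_tgt j) then 1 else 0 := by
      rw [hv]; simp [hs₂]
    simp only [run, hrun]
    rw [Finset.sum_range_succ, ← hI x hx]
    by_cases hxj : x = s.arr a_src j
    · subst hxj
      simp [hx₂, ha₂, hv']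
    · simp [hx₂, ha₂, hxj, Ne.symm hxj]

/-- `r_cnt := #{i < N | test(i)}`. -/
def count (N : ℕ) (test : RAMProg) : RAMProg :=
  .const r_cnt 0 ;; forLoop r_i N (test ;; .add r_cnt r_cnt r_f)

open scoped Classical in
theorem count_runs {N n : ℕ} {test : RAMProg} {s : RAMState}
    {P : ℕ → Prop} (ht : IsTest test) (hN : s.reg N = n)
    (hN' : N = r_n ∨ N = r_v)
    (hP : ∀ s', (count N test).Frame s s' → s'.reg r_i < n →
      (test.run s').reg r_f = if P (s'.reg r_i) then 1 else 0) :
    (count N test).Runs s (12 * (n + 1)) fun s' => s'.reg r_cnt =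
      ((Finset.range n).filter P).card := by
  have w : ∀ r, r ≠ r_f → r ≠ r_a → r ≠ r_b → test.writesReg r = false :=
    fun r h1 h2 h3 => ht.writesReg h1 h2 h3
  refine Runs.seq (T₁ := 1) (T₂ := n * 12 + 2) (R := fun s' => s'.reg r_cnt = 0)
    (Runs.of_run rfl le_rfl (by simp)) (fun s₁ hf₁ h₁ => ?_) (by omega)
  have hN₁ : s₁.reg N = n :=
    (hf₁.reg N (by rcases hN' with rfl | rfl <;> rfl)).trans hN
  refine Runs.forLoop (fun j s' => s'.reg r_cnt = ((Finset.range j).filter P).card) (T := 9)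
      hN₁ (by simp [w]) (by rcases hN' with rfl | rfl <;> simp [w])
      (by omega) (by decide) (by omega) (by simpa using h₁) (fun j hj s' hj' hf hI => ?_) le_rfl
      (fun s' _ h => h)
  refine Runs.of_run (by simp [ht.loopFree]) (by have := ht.cost_le; simp; omega) ?_
  have hv := hP s' (hf₁.seq_left.trans hf.seq_right) (by omega)
  rw [Finset.range_add_one, Finset.filter_insert]
  have := ht.run_reg s' (r := r_cnt) (by decide) (by decide) (by decide)
  simp [this, hv, hj', hI]
  split_ifs <;> simp

end RAMProg

namespace RAMProg

/-! ### The degeneracy ranking -/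

/-- After `j` vertices have been ranked; the unranked vertices have rank `0`. -/
structure PartialRanking (H : SimpleGraph ℕ) (n d j : ℕ) (pos : ℕ → ℕ) : Prop where
  card_eq : ((Finset.range n).filter fun v => pos v = 0).card = n - j
  lt : ∀ v < n, pos v ≠ 0 → n - j < pos v
  inj : ∀ u < n, ∀ v < n, pos u = pos v → pos u ≠ 0 → u = v
  card_le : ∀ v < n, pos v ≠ 0 → (outNbrs H n pos v).card ≤ d

theorem PartialRanking.isRanking {H : SimpleGraph ℕ} {n d : ℕ} {pos : ℕ → ℕ}
    (h : PartialRanking H n d n pos) : IsRanking H n d pos := by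
  have h0 : ∀ v < n, pos v ≠ 0 := fun v hv h0 => by
    have := h.card_eq
    rw [Nat.sub_self, Finset.card_eq_zero] at this
    exact Finset.notMem_empty v (this ▸ Finset.mem_filter.2 ⟨Finset.mem_range.2 hv, h0⟩)
  exact ⟨fun u hu v hv he => h.inj u hu v hv he (h0 u hu), fun v hv => h.card_le v hv (h0 v hv)⟩

open scoped Classical in
theorem PartialRanking.step {H : SimpleGraph ℕ} {n d j : ℕ} {pos : ℕ → ℕ} {w : ℕ}
    (h : PartialRanking H n d j pos) (hj : j < n) (hw : w < n) (hw0 : pos w = 0)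
    (hd : ((Finset.range n).filter fun y => H.Adj w y ∧ pos y = 0).card ≤ d) :
    PartialRanking H n d (j + 1) (Function.update pos w (n - j)) := by
  have hu : ∀ v, Function.update pos w (n - j) v = if v = w then n - j else pos v :=
    fun v => Function.update_apply _ _ _ _
  refine ⟨?_, ?_, ?_, ?_⟩
  · have : ((Finset.range n).filter fun v => Function.update pos w (n - j) v = 0) =
        ((Finset.range n).filter fun v => pos v = 0).erase w := by
      ext v
      simp only [hu, Finset.mem_filter, Finset.mem_erase, Finset.mem_range]
      split_ifs with hv
      · simp [hv]; omega
      · simp [hv]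
    rw [this, Finset.card_erase_of_mem (by simp [hw, hw0]), h.card_eq]
    omega
  · intro v hv
    rw [hu]
    split_ifs with hvw
    · omega
    · intro h0
      have := h.lt v hv h0
      omega
  · intro u hun v hvn
    rw [hu, hu]
    have h1 := h.lt u hun
    have h2 := h.lt v hvn
    split_ifs with huw hvw hvw
    · intros; omega
    · intro he h0
      have := h2 (by omega)
      omega
    · intro he h0
      have := h1 (by omega)
      omega
    · exact h.inj u hun v hvn
  · intro v hv
    by_cases hvw : v = w
    · subst hvw
      intro _
      refine le_trans (Finset.card_le_card fun y hy => ?_) hd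
      simp only [outNbrs, Finset.mem_filter, Finset.mem_range, hu, if_true] at hy ⊢
      refine ⟨hy.1, hy.2.1, ?_⟩
      by_contra h0
      have := h.lt y hy.1 h0
      have := hy.2.2
      rw [if_neg hy.2.1.ne'] at this
      omega
    · rw [hu, if_neg hvw]
      intro h0
      refine le_trans (Finset.card_le_card fun y hy => ?_) (h.card_le v hv h0)
      simp only [outNbrs, Finset.mem_filter, Finset.mem_range, hu, if_neg hvw] at hy ⊢
      refine ⟨hy.1, hy.2.1, ?_⟩
      by_cases hyw : y = w
      · subst hyw
        omega
      · simpa [hyw] using hy.2.2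

/-- Is `y` unranked? -/
def unrankedTest : RAMProg := .const r_a 1 ;; .load r_b a_pos r_y ;; .sub r_f r_a r_b

theorem isTest_unrankedTest : IsTest unrankedTest :=
  ⟨rfl, by decide, fun r => by simp [unrankedTest]; omega, fun _ => rfl⟩

/-- `r_cnt :=` some unranked vertex of degree at most `d` among the unranked vertices. -/
def pick (d : ℕ) : RAMProg :=
  forLoop r_i r_n (.const r_f 1 ;; .const r_x (d + 1) ;; .load r_a a_pos r_i ;;
    .load r_b a_deg r_i ;;
    .ifLt r_a r_f (.ifLt r_b r_x (.const 0 0 ;; .add r_cnt r_i 0) .skip) .skip)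

theorem pick_runs {n d : ℕ} {s : RAMState} (hn : s.reg r_n = n)
    (hex : ∃ i < n, s.arr a_pos i = 0 ∧ s.arr a_deg i ≤ d) :
    (pick d).Runs s (n * 11 + 2) fun s' => s'.reg r_cnt < n ∧ s.arr a_pos (s'.reg r_cnt) = 0 ∧
      s.arr a_deg (s'.reg r_cnt) ≤ d := by
  refine Runs.forLoop (fun j s' => (∃ i < j, s.arr a_pos i = 0 ∧ s.arr a_deg i ≤ d) →
    s'.reg r_cnt < n ∧ s.arr a_pos (s'.reg r_cnt) = 0 ∧ s.arr a_deg (s'.reg r_cnt) ≤ d)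
    (T := 8) hn rfl rfl (by decide) (by decide) (by decide) (by simp)
    (fun j hj s' hj' hf hI => ?_) le_rfl (fun s' hf h => h hex)
  have e4 : s'.arr a_pos = s.arr a_pos := hf.arr _ rfl
  have e10 : s'.arr a_deg = s.arr a_deg := hf.arr _ rfl
  refine Runs.of_run rfl (by simp) ?_
  by_cases hg : s.arr a_pos j = 0 ∧ s.arr a_deg j ≤ d
  · intro _
    simp [e4, e10, hj', hg.1, Nat.lt_succ_of_le hg.2, hj, hg.2]
  · rintro ⟨i, hi, hgi⟩
    have hij : i ≠ j := fun h => hg (h ▸ hgi)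
    have hI' := hI ⟨i, by omega, hgi⟩
    simp only [not_and_or, not_le] at hg
    simp only [run, RAMState.setReg_reg, RAMState.setReg_arr, e4, e10, hj']
    by_cases h1 : s.arr a_pos j < 1
    · have h2 : ¬ s.arr a_deg j < d + 1 := by omega
      simpa [h1, h2] using hI'
    · simpa [h1] using hI'

/-- Rank one more vertex. -/
def rankStep (d : ℕ) : RAMProg :=
  tally a_deg unrankedTest ;; pick d ;; .sub r_a r_n r_v ;; .store a_pos r_cnt r_a

/-- Compute a degeneracy ranking in the array `a_pos`. -/
def rank (d : ℕ) : RAMProg := forLoop r_v r_n (rankStep d)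

theorem rank_runs {H : SimpleGraph ℕ} {n M d : ℕ} {s : RAMState} (hs : Stored H n M s)
    (hdeg : DegenerateOn H (Finset.range n) d) (h0 : ∀ v, s.arr a_pos v = 0) :
    (rank d).Runs s (n * (40 * (n + M + 1)) + 2) fun s' => IsRanking H n d (s'.arr a_pos) := by
  classical
  refine Runs.forLoop (fun j s' => PartialRanking H n d j (s'.arr a_pos))
    (T := 35 * (n + M + 1)) hs.n_eq rfl rfl (by decide) (by decide) (by decide) ?_
    (fun j hj s' hj' hf hI => ?_) (by gcongr; omega) (fun s' _ h => h.isRanking)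
  · constructor <;> simp [h0]
  have hs' : Stored H n M s' := hs.of_frame hf
  refine Runs.seq (tally_runs (P := fun _ y => s'.arr a_pos y = 0) isTest_unrankedTest hs'
    (by decide) (by decide) (fun s₁ hf₁ _ _ => ?_))
    (T₂ := 15 * (n + M + 1)) (fun s₁ hf₁ h₁ => ?_) (by omega)
  · have : s₁.arr a_pos = s'.arr a_pos := hf₁.arr _ rfl
    simp [unrankedTest, this]
    split_ifs <;> omega
  have e4 : s₁.arr a_pos = s'.arr a_pos := hf₁.arr _ rfl
  have en : s₁.reg r_n = n := (hs'.of_frame hf₁).n_eq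
  have ev : s₁.reg r_v = j := (hf₁.reg _ rfl).trans hj'
  refine Runs.seq (T₁ := n * 11 + 2) (T₂ := 2) (pick_runs (d := d) en ?_)
    (fun s₂ hf₂ h₂ => ?_) (by omega)
  · obtain ⟨v, hv, hvd⟩ := hdeg ((Finset.range n).filter fun v => s'.arr a_pos v = 0)
      (Finset.filter_subset _ _) (Finset.card_pos.1 (by rw [hI.card_eq]; omega))
    simp only [Finset.mem_filter, Finset.mem_range] at hv
    refine ⟨v, hv.1, by rw [e4]; exact hv.2, ?_⟩
    rw [h₁ v hv.1]
    refine le_trans (le_of_eq ?_) hvd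
    congr 1
    ext y
    simp only [Finset.mem_filter]
    tauto
  · rw [e4] at h₂
    obtain ⟨hw, hw0, hwd⟩ := h₂
    rw [h₁ _ hw] at hwd
    have e4' : s₂.arr a_pos = s'.arr a_pos := (hf₂.arr _ rfl).trans e4
    have en' : s₂.reg r_n = n := (hf₂.reg _ rfl).trans en
    have ev' : s₂.reg r_v = j := (hf₂.reg _ rfl).trans ev
    refine Runs.of_run rfl le_rfl ?_
    convert hI.step hj hw hw0 (by convert hwd) using 1
    ext x
    simp [Function.update_apply, e4', en', ev']

/-! ### The table of thresholds -/

/-- `a_cap[j] := capSeq k d j` for `j ≤ d + 1`. -/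
def caps (d : ℕ) : RAMProg :=
  .const r_cnt 0 ;; .const r_size (d + 1) ;; forLoop r_v r_size (
    .add r_b r_cnt r_size ;; .const r_cnt 1 ;; forLoop r_i r_k (.add r_cnt r_cnt r_b) ;;
    .const r_f 1 ;; .add r_f r_v r_f ;; .store a_cap r_f r_cnt)

theorem caps_runs {d k : ℕ} {s : RAMState} (hk : s.reg r_k = k) (h0 : s.arr a_cap 0 = 0) :
    (caps d).Runs s ((d + 1) * (4 * k + 10) + 4) fun s' =>
      ∀ j ≤ d + 1, s'.arr a_cap j = capSeq k d j := by
  rw [show (d + 1) * (4 * k + 10) + 4 = 1 + (1 + ((d + 1) * (4 * k + 7 + 3) + 2)) by ring]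
  refine Runs.seq (R := fun s' => s' = s.setReg r_cnt 0) (Runs.of_run rfl le_rfl rfl)
    (fun s₁ _ h₁ => ?_) le_rfl
  refine Runs.seq (R := fun s' => s' = s₁.setReg r_size (d + 1)) (Runs.of_run rfl le_rfl rfl)
    (fun s₂ _ h₂ => ?_) le_rfl
  subst h₁
  subst h₂
  refine Runs.forLoop (fun j s' => s'.reg r_cnt = capSeq k d j ∧
    ∀ i ≤ j, s'.arr a_cap i = capSeq k d i)
    (T := 4 * k + 7) (n := d + 1) (by simp) rfl rfl (by decide) (by decide) (by decide)
    (by simp [capSeq, h0]) (fun j hj s' hj' hf hI => ?_) le_rfl (fun s' _ h => h.2)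
  have ek : s'.reg r_k = k := by rw [hf.reg _ rfl]; simpa using hk
  have esz : s'.reg r_size = d + 1 := by rw [hf.reg _ rfl]; simp
  refine Runs.seq (T₁ := 1) (T₂ := 4 * k + 6)
    (R := fun s'' => s'' = s'.setReg r_b (capSeq k d j + (d + 1)))
    (Runs.of_run rfl le_rfl (by simp [hI.1, esz])) (fun s₁ _ h₁ => ?_) (by omega)
  refine Runs.seq (T₁ := 1) (T₂ := 4 * k + 5) (R := fun s' => s' = s₁.setReg r_cnt 1)
    (Runs.of_run rfl le_rfl rfl) (fun s₂ _ h₂ => ?_) (by omega)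
  subst h₁
  subst h₂
  refine Runs.seq (T₁ := k * 4 + 2) (T₂ := 3) (R := fun s'' => s''.reg r_cnt = capSeq k d (j + 1))
    ?_ (fun s₁ hf₁ h₁ => ?_) (by omega)
  · refine Runs.forLoop (fun i s'' => s''.reg r_cnt = i * (capSeq k d j + (d + 1)) + 1)
      (T := 1) (n := k) (by simpa using ek) rfl rfl (by decide) (by decide) (by decide)
      (by simp) (fun i hi s'' hi' hf' hI' => ?_) le_rfl (fun s' _ h => by rw [h, capSeq]; ring)
    have eb : s''.reg r_b = capSeq k d j + (d + 1) := by rw [hf'.reg _ rfl]; simp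
    refine Runs.of_run rfl le_rfl ?_
    simp [hI', eb]
    ring
  · have ev : s₁.reg r_v = j := by rw [hf₁.reg _ rfl]; simpa using hj'
    have e9 : s₁.arr a_cap = s'.arr a_cap := by rw [hf₁.arr _ rfl]; simp
    refine Runs.of_run rfl le_rfl ⟨by simp [h₁], fun i hi => ?_⟩
    by_cases hij : i = j + 1
    · simp [ev, h₁, hij]
    · simpa [ev, e9, hij] using hI.2 i (by omega)

end RAMProg

namespace RAMProg

/-! ### The colouring -/

/-- The state holds the ranking `pos`, the set `B` of blue vertices and the thresholds. -/
structure Painted (H : SimpleGraph ℕ) (n M d k : ℕ) (pos : ℕ → ℕ) (B : Finset ℕ)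
    (s : RAMState) : Prop where
  stored : Stored H n M s
  pos_eq : s.arr a_pos = pos
  col_eq : ∀ x < n, s.arr a_col x = if x ∈ B then 1 else 0
  cap_eq : ∀ j ≤ d + 1, s.arr a_cap j = capSeq k d j

/-- The state holds the set `Z`, as marks, and its size. -/
structure Marked (n : ℕ) (Z : Finset ℕ) (s : RAMState) : Prop where
  mark_eq : ∀ x < n, s.arr a_mark x = if x ∈ Z then 1 else 0
  size_eq : s.reg r_size = Z.card

theorem Painted.of_frame {H : SimpleGraph ℕ} {n M d k : ℕ} {pos : ℕ → ℕ} {B : Finset ℕ}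
    {s s' : RAMState} {p : RAMProg}
    (h : Painted H n M d k pos B s) (hf : p.Frame s s') (h1 : p.writesReg r_n = false := by rfl)
    (h2 : p.writesReg r_arcs = false := by rfl) (h3 : p.writesArr a_src = false := by rfl)
    (h4 : p.writesArr a_tgt = false := by rfl) (h5 : p.writesArr a_pos = false := by rfl)
    (h6 : p.writesArr a_col = false := by rfl) (h7 : p.writesArr a_cap = false := by rfl) :
    Painted H n M d k pos B s' :=
  ⟨h.stored.of_frame hf h1 h2 h3 h4, (hf.arr _ h5).trans h.pos_eq,
    by rw [hf.arr _ h6]; exact h.col_eq, by rw [hf.arr _ h7]; exact h.cap_eq⟩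

theorem Marked.of_frame {n : ℕ} {Z : Finset ℕ} {s s' : RAMState} {p : RAMProg}
    (h : Marked n Z s) (hf : p.Frame s s') (h1 : p.writesReg r_size = false := by rfl)
    (h2 : p.writesArr a_mark = false := by rfl) : Marked n Z s' :=
  ⟨by rw [hf.arr _ h2]; exact h.mark_eq, (hf.reg _ h1).trans h.size_eq⟩

/-- Is `y` a marked out-neighbour of `x`? -/
def markedOutTest : RAMProg :=
  .load r_a a_pos r_x ;; .load r_b a_pos r_y ;;
    .ifLt r_b r_a (.load r_f a_mark r_y) (.const r_f 0)

theorem isTest_markedOutTest : IsTest markedOutTest :=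
  ⟨rfl, by decide, fun r => by simp [markedOutTest]; omega, fun _ => rfl⟩

/-- Is `i` a blue vertex with at least `r_size` hits? -/
def blueHitTest : RAMProg :=
  .load r_a a_hit r_i ;; .load r_f a_col r_i ;; .ifLt r_a r_size (.const r_f 0) .skip

theorem isTest_blueHitTest : IsTest blueHitTest :=
  ⟨rfl, by decide, fun r => by simp [blueHitTest]; omega, fun _ => rfl⟩

/-- Set the flag if the marked set has too many blue vertices above it. -/
def checkMarked (d : ℕ) : RAMProg :=
  tally a_hit markedOutTest ;; count r_n blueHitTest ;; .const r_a (d + 1) ;;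
    .sub r_a r_a r_size ;; .load r_a a_cap r_a ;; .ifLt r_cnt r_a .skip (.const r_flag 1)

/-- The threshold for `Z` is reached. -/
def Full (H : SimpleGraph ℕ) (n d k : ℕ) (pos : ℕ → ℕ) (B Z : Finset ℕ) : Prop :=
  capSeq k d (d + 1 - Z.card) ≤ (above H n pos B Z).card

open scoped Classical in
/-- The flag register tells whether `p` holds. -/
def Flag (p : Prop) (s : RAMState) : Prop := s.reg r_flag = if p then 1 else 0

theorem checkMarked_runs {H : SimpleGraph ℕ} {n M d k : ℕ} {pos : ℕ → ℕ} {B Z : Finset ℕ}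
    {p : Prop} {s : RAMState} (hs : Painted H n M d k pos B s) (hB : B ⊆ Finset.range n)
    (hZ : Marked n Z s) (hp : Flag p s) :
    (checkMarked d).Runs s (40 * (n + M + 1)) (Flag (p ∨ Full H n d k pos B Z)) := by
  classical
  refine Runs.seq (tally_runs (P := fun x y => pos y < pos x ∧ y ∈ Z) isTest_markedOutTest
    hs.stored (by decide) (by decide) (fun s₁ hf₁ hx hy => ?_))
    (T₂ := 20 * (n + M + 1)) (fun s₁ hf₁ h₁ => ?_) (by omega)
  · have e1 : s₁.arr a_pos = pos := (hf₁.arr _ rfl).trans hs.pos_eq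
    have e2 : s₁.arr a_mark = s.arr a_mark := hf₁.arr _ rfl
    by_cases h : pos (s₁.reg r_y) < pos (s₁.reg r_x)
    · simp [markedOutTest, e1, e2, h, hZ.mark_eq _ hy]
    · simp [markedOutTest, e1, h]
  have hs₁ := hs.of_frame hf₁
  have hZ₁ := hZ.of_frame hf₁
  have hp₁ : Flag p s₁ := (hf₁.reg _ rfl).trans hp
  refine Runs.seq (T₁ := 12 * (n + 1)) (T₂ := 5) (count_runs (P := fun u => u ∈ above H n pos B Z)
    isTest_blueHitTest hs₁.stored.n_eq (Or.inl rfl) (fun s₂ hf₂ hi => ?_))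
    (fun s₂ hf₂ h₂ => ?_) (by omega)
  · have e1 : s₂.arr a_hit = s₁.arr a_hit := hf₂.arr _ rfl
    have e2 : s₂.arr a_col = s₁.arr a_col := hf₂.arr _ rfl
    have e3 : s₂.reg r_size = Z.card := (hf₂.reg _ rfl).trans hZ₁.size_eq
    set u := s₂.reg r_i
    have key : (s₁.arr a_hit u < Z.card) ↔ ¬ Z ⊆ outNbrs H n pos u := by
      have : s₁.arr a_hit u = (Z ∩ outNbrs H n pos u).card := by
        rw [h₁ u hi]
        congr 1
        ext y
        simp only [outNbrs, Finset.mem_filter, Finset.mem_inter]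
        tauto
      rw [this]
      constructor
      · intro hlt hsub
        rw [Finset.inter_eq_left.2 hsub] at hlt
        omega
      · intro hsub
        refine Finset.card_lt_card ⟨Finset.inter_subset_left, fun h => hsub fun z hz => ?_⟩
        exact (Finset.mem_inter.1 (h hz)).2
    by_cases h : Z ⊆ outNbrs H n pos u
    · have h' := mt key.1 (not_not.2 h)
      simp [blueHitTest, e1, e2, e3, u, h', above, h, hs₁.col_eq u hi]
    · have h' := key.2 h
      simp [blueHitTest, e1, e2, e3, u, h', above, h]
  · have hs₂ := hs₁.of_frame hf₂
    have e3 : s₂.reg r_size = Z.card := (hf₂.reg _ rfl).trans hZ₁.size_eq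
    have e4 : s₂.reg r_flag = s₁.reg r_flag := hf₂.reg _ rfl
    have hc : s₂.reg r_cnt = (above H n pos B Z).card := by
      rw [h₂]
      congr 1
      ext u
      simp only [Finset.mem_filter, Finset.mem_range, and_iff_right_iff_imp]
      exact fun hu => by simpa using hB (Finset.mem_filter.1 hu).1
    refine Runs.of_run rfl (by simp) ?_
    have hcap := hs₂.cap_eq (d + 1 - Z.card) (by omega)
    unfold Flag at hp₁ ⊢
    by_cases h : (above H n pos B Z).card < capSeq k d (d + 1 - Z.card)
    · have h' : ¬ Full H n d k pos B Z := not_le.2 h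
      simp [e3, hcap, hc, h, e4, hp₁, h']
    · have h' : Full H n d k pos B Z := not_lt.1 h
      simp [e3, hcap, hc, h, h']

/-- Run `checkMarked` on all sets that arise from the marked set by adding some of
the first `j` entries of the list. -/
def enum (d : ℕ) : ℕ → RAMProg
  | 0 => checkMarked d
  | j + 1 => enum d j ;; .const r_a j ;; .ifLt r_a r_len
      ((.load r_a a_list r_a ;; .const r_b 1 ;; .store a_mark r_a r_b ;; .add r_size r_size r_b) ;;
        enum d j ;;
        (.const r_a j ;; .load r_a a_list r_a ;; .const r_b 0 ;; .store a_mark r_a r_b ;;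
          .const r_b 1 ;; .sub r_size r_size r_b)) .skip

theorem enum_writesReg (d j : ℕ) {r : ℕ}
    (hr : r ∉ [0, r_i, r_x, r_y, r_f, r_a, r_b, r_cnt, r_size, r_flag]) :
    (enum d j).writesReg r = false := by
  simp only [List.mem_cons, List.not_mem_nil, or_false, not_or] at hr
  induction j with
  | zero =>
    simp [enum, checkMarked, tally, count, markedOutTest, blueHitTest]
    omega
  | succ j ih =>
    simp [enum, ih]
    omega

theorem enum_writesArr (d j : ℕ) {A : ℕ} (hA : A ∉ [a_hit, a_mark]) :
    (enum d j).writesArr A = false := by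
  simp only [List.mem_cons, List.not_mem_nil, or_false, not_or] at hA
  induction j with
  | zero =>
    simp [enum, checkMarked, tally, count, markedOutTest, blueHitTest]
    omega
  | succ j ih =>
    simp [enum, ih]
    omega

theorem Painted.of_frame_enum {H : SimpleGraph ℕ} {n M d k : ℕ} {pos : ℕ → ℕ} {B : Finset ℕ}
    {s s' : RAMState} {d' j : ℕ} (h : Painted H n M d k pos B s) (hf : (enum d' j).Frame s s') :
    Painted H n M d k pos B s' :=
  h.of_frame hf (enum_writesReg _ _ (by decide)) (enum_writesReg _ _ (by decide))
    (enum_writesArr _ _ (by decide)) (enum_writesArr _ _ (by decide))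
    (enum_writesArr _ _ (by decide)) (enum_writesArr _ _ (by decide))
    (enum_writesArr _ _ (by decide))

theorem exists_subset_insert_iff {V : Type*} [DecidableEq V] (S : Finset V) (a : V)
    (p : Finset V → Prop) (Z : Finset V) :
    (∃ Y ⊆ insert a S, p (Z ∪ Y)) ↔
      (∃ Y ⊆ S, p (Z ∪ Y)) ∨ ∃ Y ⊆ S, p (insert a Z ∪ Y) := by
  constructor
  · rintro ⟨Y, hY, hp⟩
    by_cases ha : a ∈ Y
    · refine Or.inr ⟨Y.erase a, Finset.subset_insert_iff.1 hY, ?_⟩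
      convert hp using 1
      rw [Finset.insert_union, ← Finset.union_insert, Finset.insert_erase ha]
    · exact Or.inl ⟨Y, (Finset.subset_insert_iff_of_notMem ha).1 hY, hp⟩
  · rintro (⟨Y, hY, hp⟩ | ⟨Y, hY, hp⟩)
    · exact ⟨Y, hY.trans (Finset.subset_insert _ _), hp⟩
    · exact ⟨insert a Y, Finset.insert_subset_insert _ hY, by
        rwa [Finset.union_insert, ← Finset.insert_union]⟩

theorem enum_runs {H : SimpleGraph ℕ} {n M d k c : ℕ} {pos ℓ : ℕ → ℕ} {B : Finset ℕ}
    (hB : B ⊆ Finset.range n) (hℓ : Set.InjOn ℓ (Finset.range c)) (j : ℕ)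
    (Z : Finset ℕ) (p : Prop) (s : RAMState) (hs : Painted H n M d k pos B s)
    (hlist : s.arr a_list = ℓ) (hlen : s.reg r_len = c) (hZ : Marked n Z s) (hp : Flag p s)
    (hdisj : ∀ i < c, i < j → ℓ i ∉ Z) :
    (enum d j).Runs s (2 ^ j * (40 * (n + M + 1) + 13) - 13) fun s' => Marked n Z s' ∧
      Flag (p ∨ ∃ Y ⊆ (Finset.range (min j c)).image ℓ, Full H n d k pos B (Z ∪ Y)) s' := by
  induction j generalizing Z p s with
  | zero =>
    refine (checkMarked_runs hs hB hZ hp).mono (by omega) fun s' hf h => ⟨hZ.of_frame hf, ?_⟩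
    simpa using h
  | succ j ih =>
    have hT : 13 ≤ 2 ^ j * (40 * (n + M + 1) + 13) := le_trans (by omega)
      (Nat.le_mul_of_pos_left _ (by positivity))
    rw [pow_succ, mul_right_comm]
    set X := 2 ^ j * (40 * (n + M + 1) + 13) with hX
    refine Runs.seq (ih Z p s hs hlist hlen hZ hp fun i hi hij => hdisj i hi (by omega))
      (T₂ := X) (fun s₁ hf₁ h₁ => ?_) (by omega)
    obtain ⟨hZ₁, hp₁⟩ := h₁
    have hs₁ := hs.of_frame_enum hf₁
    have hlist₁ : s₁.arr a_list = ℓ := (hf₁.arr _ (enum_writesArr _ _ (by decide))).trans hlist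
    have hlen₁ : s₁.reg r_len = c := (hf₁.reg _ (enum_writesReg _ _ (by decide))).trans hlen
    refine Runs.seq (T₁ := 1) (T₂ := X - 1) (R := fun s' => s' = s₁.setReg r_a j)
      (Runs.of_run rfl le_rfl rfl) (fun s₂ hf₂ h₂ => ?_) (by omega)
    have hs₂ := hs₁.of_frame hf₂
    have hZ₂ := hZ₁.of_frame hf₂
    subst h₂
    rw [show X - 1 = (X - 2) + 1 by omega]
    refine Runs.ifLt (fun hlt => ?_) (fun hlt => ?_)
    · replace hlt : j < c := by simpa [hlen₁] using hlt
      have hslot : (Finset.range (min (j + 1) c)).image ℓ =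
          insert (ℓ j) ((Finset.range (min j c)).image ℓ) := by
        rw [show min (j + 1) c = min j c + 1 by omega, Finset.range_add_one, Finset.image_insert,
          show min j c = j by omega]
      rw [hslot]
      simp only [exists_subset_insert_iff, ← or_assoc]
      have hjZ : ℓ j ∉ Z := hdisj j hlt (by omega)
      refine Runs.seq (T₁ := 4) (T₂ := X - 6)
        (R := fun s' => Marked n (insert (ℓ j) Z) s') (Runs.of_run rfl le_rfl ?_)
        (fun s₃ hf₃ h₃ => ?_) (by omega)
      · refine ⟨fun x hx => ?_, ?_⟩
        · by_cases hxj : x = ℓ j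
          · simp [hlist₁, hxj]
          · simpa [hlist₁, hxj] using hZ₁.mark_eq x hx
        · simp [Finset.card_insert_of_notMem hjZ, hZ₁.size_eq]
      have hs₃ := hs₂.of_frame hf₃
      refine Runs.seq (T₁ := X - 13) (T₂ := 6) (ih (insert (ℓ j) Z) (s := s₃) hs₃ ?_ ?_ h₃
        (p := p ∨ ∃ Y ⊆ (Finset.range (min j c)).image ℓ, Full H n d k pos B (Z ∪ Y)) ?_ ?_)
        (fun s₄ hf₄ h₄ => ?_) (by omega)
      · rw [hf₃.arr _ rfl]; simpa using hlist₁
      · rw [hf₃.reg _ rfl]; simpa using hlen₁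
      · unfold Flag at hp₁ ⊢
        rw [hf₃.reg _ rfl]; simpa using hp₁
      · intro i hi hij hmem
        rcases Finset.mem_insert.1 hmem with h | h
        · have := hℓ (by simpa using hi) (by simpa using hlt) h
          omega
        · exact hdisj i hi (by omega) h
      · have hlist₄ : s₄.arr a_list = ℓ := by
          rw [hf₄.arr _ (enum_writesArr _ _ (by decide)), hf₃.arr _ rfl]; simpa using hlist₁
        refine Runs.of_run rfl le_rfl ⟨⟨fun x hx => ?_, ?_⟩, ?_⟩
        · by_cases hxj : x = ℓ j
          · simp [hlist₄, hxj, hjZ]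
          · simpa [hlist₄, hxj] using h₄.1.mark_eq x hx
        · simp [h₄.1.size_eq, Finset.card_insert_of_notMem hjZ]
        · have := h₄.2
          unfold Flag at this ⊢
          simpa using this
    · replace hlt : ¬ j < c := by simpa [hlen₁] using hlt
      rw [show min (j + 1) c = min j c by omega]
      exact Runs.of_run rfl (by simp; omega) ⟨hZ₂, by unfold Flag at hp₁ ⊢; simpa using hp₁⟩

/-- Is `x` an out-neighbour of `v = y`? -/
def outTest : RAMProg :=
  .ifLt r_y r_v (.const r_f 0) (.ifLt r_v r_y (.const r_f 0)
    (.load r_a a_pos r_x ;; .load r_b a_pos r_y ;; .ifLt r_a r_b (.const r_f 1) (.const r_f 0)))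

theorem isTest_outTest : IsTest outTest :=
  ⟨rfl, by decide, fun r => by simp [outTest]; omega, fun _ => rfl⟩

/-- List the vertices with a hit. -/
def listHits : RAMProg :=
  .const r_len 0 ;; forLoop r_i r_n (.load r_a a_hit r_i ;; .const r_b 0 ;;
    .ifLt r_b r_a (.store a_list r_len r_i ;; .const r_b 1 ;; .add r_len r_len r_b) .skip)

theorem listHits_runs {n : ℕ} {W : Finset ℕ} {s : RAMState} (hn : s.reg r_n = n)
    (hW : W ⊆ Finset.range n) (hhit : ∀ x < n, s.arr a_hit x = if x ∈ W then 1 else 0) :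
    listHits.Runs s (12 * (n + 1)) fun s' => s'.reg r_len = W.card ∧
      (Finset.range W.card).image (s'.arr a_list) = W := by
  refine Runs.seq (T₁ := 1) (T₂ := n * 9 + 2) (R := fun s' => s' = s.setReg r_len 0)
    (Runs.of_run rfl le_rfl rfl) (fun s₁ hf₁ h₁ => ?_) (by omega)
  subst h₁
  refine Runs.forLoop (fun j s' => s'.reg r_len = (W.filter (· < j)).card ∧
    (Finset.range (s'.reg r_len)).image (s'.arr a_list) = W.filter (· < j)) (T := 6) (n := n)
    (by simpa using hn) rfl rfl (by decide) (by decide) (by decide) (by simp)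
    (fun j hj s' hj' hf hI => ?_) le_rfl (fun s' _ h => ?_)
  · have e5 : s'.arr a_hit = s.arr a_hit := by rw [hf.arr _ rfl]; simp
    refine Runs.of_run rfl le_rfl ?_
    obtain ⟨h1, h2⟩ := hI
    by_cases hjW : j ∈ W
    · have hins : W.filter (· < j + 1) = insert j (W.filter (· < j)) := by
        ext x
        simp only [Finset.mem_filter, Finset.mem_insert]
        constructor
        · rintro ⟨hx, hlt⟩
          by_cases h : x = j
          · exact Or.inl h
          · exact Or.inr ⟨hx, by omega⟩
        · rintro (rfl | ⟨hx, hlt⟩)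
          · exact ⟨hjW, by omega⟩
          · exact ⟨hx, by omega⟩
      rw [hins, Finset.card_insert_of_notMem (by simp)]
      simp only [run, RAMState.setReg_reg, RAMState.setReg_arr, e5, hj', hhit j hj, hjW]
      rw [h1] at h2
      generalize hc : (W.filter (· < j)).card = c at h1 h2 ⊢
      refine ⟨by simp [h1], ?_⟩
      simp only [reduceIte, zero_lt_one, RAMState.setReg_reg, RAMState.setArr_reg, h1,
        RAMState.setReg_arr, Nat.reduceEqDiff]
      rw [← h2, Finset.range_add_one, Finset.image_insert]
      congr 1
      · simp
      · refine Finset.image_congr fun i hi => ?_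
        have : i ≠ c := (Finset.mem_range.1 (Finset.mem_coe.1 hi)).ne
        simp [this]
    · have hins : W.filter (· < j + 1) = W.filter (· < j) := by
        refine Finset.filter_congr fun x hx => ?_
        have : x ≠ j := fun h => hjW (h ▸ hx)
        omega
      rw [hins]
      simp only [run, RAMState.setReg_reg, RAMState.setReg_arr, e5, hj', hhit j hj, hjW]
      simpa using ⟨h1, h2⟩
  · have : W.filter (· < n) = W :=
      Finset.filter_true_of_mem fun x hx => by simpa using hW hx
    rw [this] at h
    exact ⟨h.1, by rw [← h.1]; exact h.2⟩

/-- Decide the colour of the vertex `v`. -/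
def colorStep (d : ℕ) : RAMProg :=
  tally a_hit outTest ;; listHits ;; (.const r_size 0 ;; .const r_flag 0) ;; enum d d ;;
    .const r_a 1 ;; .sub r_a r_a r_flag ;; .store a_col r_v r_a

/-- Compute the set of blue vertices in the array `a_col`. -/
def color (d : ℕ) : RAMProg := forLoop r_v r_n (colorStep d)

theorem colorStep_writesReg (d : ℕ) {r : ℕ}
    (hr : r ∉ [0, r_i, r_x, r_y, r_f, r_a, r_b, r_cnt, r_size, r_flag, r_len]) :
    (colorStep d).writesReg r = false := by
  have h : (enum d d).writesReg r = false := enum_writesReg d d (by simp at hr ⊢; tauto)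
  simp only [List.mem_cons, List.not_mem_nil, or_false, not_or] at hr
  simp [colorStep, h, tally, listHits, outTest]
  omega

theorem colorStep_writesArr (d : ℕ) {A : ℕ} (hA : A ∉ [a_hit, a_mark, a_list, a_col]) :
    (colorStep d).writesArr A = false := by
  have h : (enum d d).writesArr A = false := enum_writesArr d d (by simp at hA ⊢; tauto)
  simp only [List.mem_cons, List.not_mem_nil, or_false, not_or] at hA
  simp [colorStep, h, tally, listHits, outTest]
  omega

theorem colorStep_runs {H : SimpleGraph ℕ} {n M d k v : ℕ} {pos : ℕ → ℕ} {B : Finset ℕ}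
    {s : RAMState} (hs : Painted H n M d k pos B s) (hpos : IsRanking H n d pos) (hv : v < n)
    (hvr : s.reg r_v = v) (hB : B ⊆ Finset.range v) (hmark : ∀ x < n, s.arr a_mark x = 0) :
    (colorStep d).Runs s (2 ^ d * (100 * (n + M + 1))) fun s' =>
      (∀ x < n, s'.arr a_mark x = 0) ∧
      ((Saturated H n d k pos B v ∧ Painted H n M d k pos B s') ∨
        (¬ Saturated H n d k pos B v ∧ Painted H n M d k pos (insert v B) s')) := by
  classical
  set W := outNbrs H n pos v with hW
  have hWn : W ⊆ Finset.range n := Finset.filter_subset _ _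
  have hWd : W.card ≤ d := hpos.card_le v hv
  have hBn : B ⊆ Finset.range n := hB.trans (Finset.range_subset_range.2 hv.le)
  have hT : n + M + 1 ≤ 2 ^ d * (n + M + 1) := Nat.le_mul_of_pos_left _ (by positivity)
  have hT' : 2 ^ d * (40 * (n + M + 1) + 13) ≤ 53 * (2 ^ d * (n + M + 1)) := by
    calc 2 ^ d * (40 * (n + M + 1) + 13) ≤ 2 ^ d * (53 * (n + M + 1)) := by gcongr; omega
      _ = _ := by ring
  rw [show 2 ^ d * (100 * (n + M + 1)) = 100 * (2 ^ d * (n + M + 1)) by ring]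
  set X := 2 ^ d * (n + M + 1)
  refine Runs.seq (tally_runs (P := fun x y => y = v ∧ pos x < pos y) isTest_outTest
    hs.stored (by decide) (by decide) (fun s₁ hf₁ hx hy => ?_))
    (T₂ := 80 * X) (fun s₁ hf₁ h₁ => ?_) (by omega)
  · have e1 : s₁.arr a_pos = pos := (hf₁.arr _ rfl).trans hs.pos_eq
    have e2 : s₁.reg r_v = v := (hf₁.reg _ rfl).trans hvr
    rcases lt_trichotomy (s₁.reg r_y) v with h | h | h
    · simp [outTest, e2, h, h.ne]
    · by_cases h' : pos (s₁.reg r_x) < pos v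
      · simp [outTest, e1, e2, h, h']
      · simp [outTest, e1, e2, h, h']
    · simp [outTest, e2, h, h.ne', h.not_gt]
  have hs₁ := hs.of_frame hf₁
  have hmark₁ : s₁.arr a_mark = s.arr a_mark := hf₁.arr _ rfl
  have hvr₁ : s₁.reg r_v = v := (hf₁.reg _ rfl).trans hvr
  have hhit : ∀ x < n, s₁.arr a_hit x = if x ∈ W then 1 else 0 := by
    intro x hx
    rw [h₁ x hx]
    split_ifs with hxW
    · obtain ⟨-, hadj, hlt⟩ := Finset.mem_filter.1 hxW
      rw [Finset.card_eq_one]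
      refine ⟨v, ?_⟩
      ext y
      simp only [Finset.mem_filter, Finset.mem_range, Finset.mem_singleton]
      constructor
      · exact fun h => h.2.2.1
      · rintro rfl
        exact ⟨hv, hadj.symm, rfl, hlt⟩
    · rw [Finset.card_eq_zero]
      refine Finset.eq_empty_of_forall_notMem fun y hy => ?_
      obtain ⟨-, hadj, rfl, hlt⟩ := by simpa only [Finset.mem_filter] using hy
      exact hxW (Finset.mem_filter.2 ⟨Finset.mem_range.2 hx, hadj.symm, hlt⟩)
  refine Runs.seq (T₁ := 12 * (n + 1)) (T₂ := 60 * X) (listHits_runs hs₁.stored.n_eq hWn hhit)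
    (fun s₂ hf₂ h₂ => ?_) (by omega)
  obtain ⟨hlen, himg⟩ := h₂
  have hs₂ := hs₁.of_frame hf₂
  refine Runs.seq (T₁ := 2) (T₂ := 55 * X)
    (R := fun s' => s' = (s₂.setReg r_size 0).setReg r_flag 0)
    (Runs.of_run rfl le_rfl rfl) (fun s₃ hf₃ h₃ => ?_) (by omega)
  have hs₃ := hs₂.of_frame hf₃
  have hmark₃ : s₃.arr a_mark = s.arr a_mark :=
    (hf₃.arr _ rfl).trans ((hf₂.arr _ rfl).trans hmark₁)
  have hvr₃ : s₃.reg r_v = v := (hf₃.reg _ rfl).trans ((hf₂.reg _ rfl).trans hvr₁)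
  refine Runs.seq (T₁ := 2 ^ d * (40 * (n + M + 1) + 13) - 13) (T₂ := 3)
    (enum_runs hBn (c := W.card) (ℓ := s₂.arr a_list) ?_ d ∅ False s₃ hs₃
      (by rw [h₃]; simp) (by rw [h₃]; simpa using hlen) ⟨?_, by rw [h₃]; simp⟩
      (by rw [h₃]; simp [Flag]) (by simp))
    (fun s₄ hf₄ h₄ => ?_) (by omega)
  · exact Finset.card_image_iff.1 (by rw [himg, Finset.card_range])
  · intro x hx
    rw [hmark₃]
    simpa using hmark x hx
  · rw [min_eq_right hWd, himg] at h₄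
    obtain ⟨hm₄, hf₄'⟩ := h₄
    have hs₄ := hs₃.of_frame_enum hf₄
    have hvr₄ : s₄.reg r_v = v := (hf₄.reg _ (enum_writesReg _ _ (by decide))).trans hvr₃
    have hsat : (False ∨ ∃ Y ⊆ W, Full H n d k pos B (∅ ∪ Y)) ↔ Saturated H n d k pos B v := by
      simp [Saturated, Full, hW]
    unfold Flag at hf₄'
    simp only [hsat] at hf₄'
    have hvB : v ∉ B := fun h => by simpa using hB h
    refine Runs.of_run rfl le_rfl ⟨fun x hx => by simpa using hm₄.mark_eq x hx, ?_⟩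
    by_cases h : Saturated H n d k pos B v
    · refine Or.inl ⟨h, hs₄.stored.of_eq (by simp) (by simp) (by simp) (by simp),
        by simpa using hs₄.pos_eq, fun x hx => ?_, by simpa using hs₄.cap_eq⟩
      by_cases hxv : x = v
      · simp [hxv, hvr₄, hf₄', h, hvB]
      · simpa [hxv, hvr₄] using hs₄.col_eq x hx
    · refine Or.inr ⟨h, hs₄.stored.of_eq (by simp) (by simp) (by simp) (by simp),
        by simpa using hs₄.pos_eq, fun x hx => ?_, by simpa using hs₄.cap_eq⟩
      by_cases hxv : x = v
      · simp [hxv, hvr₄, hf₄', h]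
      · simpa [hxv, hvr₄] using hs₄.col_eq x hx

theorem color_runs {H : SimpleGraph ℕ} {n M d k : ℕ} {pos : ℕ → ℕ} {s : RAMState}
    (hs : Painted H n M d k pos ∅ s) (hpos : IsRanking H n d pos)
    (hmark : ∀ x < n, s.arr a_mark x = 0) :
    (color d).Runs s (n * (2 ^ d * (110 * (n + M + 1))) + 2) fun s' =>
      ∃ B ⊆ Finset.range n, Painted H n M d k pos B s' ∧ Sparse H n d k pos B ∧
        ∀ w < n, w ∉ B → Saturated H n d k pos B w := by
  have hT : n + M + 1 ≤ 2 ^ d * (n + M + 1) := Nat.le_mul_of_pos_left _ (by positivity)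
  refine Runs.forLoop (fun j s' => (∀ x < n, s'.arr a_mark x = 0) ∧
    ∃ B ⊆ Finset.range j, Painted H n M d k pos B s' ∧ Sparse H n d k pos B ∧
        ∀ w < j, w ∉ B → Saturated H n d k pos B w) (T := 2 ^ d * (100 * (n + M + 1)))
    hs.stored.n_eq (colorStep_writesReg _ (by decide)) (colorStep_writesReg _ (by decide))
    (by decide) (by decide) (by decide) ?_ (fun j hj s' hj' hf hI => ?_) ?_ (fun s' _ h => h.2)
  · refine ⟨by simpa using hmark, ∅, by simp, ?_, fun Y => by simp [above], by simp⟩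
    exact ⟨hs.stored.of_eq (by simp) (by simp) (by simp) (by simp),
        by simpa using hs.pos_eq, by simpa using hs.col_eq, by simpa using hs.cap_eq⟩
  · obtain ⟨hm, B, hB, hp, hsp, hsat⟩ := hI
    refine (colorStep_runs hp hpos hj hj' hB hm).mono le_rfl fun s'' _ h => ?_
    obtain ⟨hm', h⟩ := h
    refine ⟨by simpa using hm', ?_⟩
    have hreg : ∀ B', Painted H n M d k pos B' s'' →
        Painted H n M d k pos B' ((s''.setReg 0 1).setReg r_v (j + 1)) := fun B' hp' =>
      ⟨hp'.stored.of_eq (by simp) (by simp) (by simp) (by simp),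
        by simpa using hp'.pos_eq, by simpa using hp'.col_eq, by simpa using hp'.cap_eq⟩
    rcases h with ⟨h, hp'⟩ | ⟨h, hp'⟩
    · refine ⟨B, hB.trans (Finset.range_subset_range.2 (by omega)), hreg B hp', hsp,
        fun w hw hwB => ?_⟩
      rcases (Nat.lt_succ_iff_lt_or_eq.1 hw) with hw | rfl
      · exact hsat w hw hwB
      · exact h
    · refine ⟨insert j B, ?_, hreg _ hp', hsp.insert h, fun w hw hwB => ?_⟩
      · rw [Finset.range_add_one]
        exact Finset.insert_subset_insert _ hB
      · rw [Finset.mem_insert, not_or] at hwB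
        exact (hsat w (by omega) hwB.2).mono (Finset.subset_insert _ _)
  · rw [show 2 ^ d * (100 * (n + M + 1)) = 100 * (2 ^ d * (n + M + 1)) by ring,
      show 2 ^ d * (110 * (n + M + 1)) = 110 * (2 ^ d * (n + M + 1)) by ring]
    gcongr
    omega

end RAMProg

namespace RAMProg

/-! ### The retained vertices -/

/-- Is `y` blue? -/
def blueTest : RAMProg := .load r_f a_col r_y

theorem isTest_blueTest : IsTest blueTest :=
  ⟨rfl, by decide, fun r => by simp [blueTest]; omega, fun _ => rfl⟩

/-- Is `x` a blue neighbour of `v = y`? -/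
def blueNbrTest : RAMProg :=
  .ifLt r_y r_v (.const r_f 0) (.ifLt r_v r_y (.const r_f 0) (.load r_f a_col r_x))

theorem isTest_blueNbrTest : IsTest blueNbrTest :=
  ⟨rfl, by decide, fun r => by simp [blueNbrTest]; omega, fun _ => rfl⟩

/-- Is `y` marked? -/
def markTest : RAMProg := .load r_f a_mark r_y

theorem isTest_markTest : IsTest markTest :=
  ⟨rfl, by decide, fun r => by simp [markTest]; omega, fun _ => rfl⟩

/-- Does `i` have all the blue neighbours of `v`? -/
def coverTest : RAMProg :=
  .load r_a a_hit r_i ;; .load r_b a_deg r_v ;; .ifLt r_a r_b (.const r_f 0) (.const r_f 1)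

theorem isTest_coverTest : IsTest coverTest :=
  ⟨rfl, by decide, fun r => by simp [coverTest]; omega, fun _ => rfl⟩

/-- Decide whether the vertex `v` is retained. -/
def retainStep : RAMProg :=
  tally a_mark blueNbrTest ;; tally a_hit markTest ;; count r_v coverTest ;;
    .load r_f a_col r_v ;; .const r_a 1 ;; .ifLt r_cnt r_a (.const r_f 1) .skip ;;
    .store a_ret r_v r_f

/-- Compute the set of retained vertices in the array `a_ret`. -/
def retain : RAMProg := tally a_deg blueTest ;; forLoop r_v r_n retainStep

theorem retainStep_runs {H : SimpleGraph ℕ} {n M v : ℕ} {B : Finset ℕ} {s : RAMState}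
    (hs : Stored H n M s) (hB : B ⊆ Finset.range n)
    (hcol : ∀ x < n, s.arr a_col x = if x ∈ B then 1 else 0)
    (hdeg : open scoped Classical in ∀ x < n, s.arr a_deg x = (B.filter (H.Adj x)).card)
    (hv : v < n) (hvr : s.reg r_v = v) :
    retainStep.Runs s (60 * (n + M + 1)) fun s' => s'.arr a_ret =
      Function.update (s.arr a_ret) v (if v ∈ retained H n B then 1 else 0) := by
  classical
  refine Runs.seq (tally_runs (P := fun x y => y = v ∧ x ∈ B) isTest_blueNbrTest
    hs (by decide) (by decide) (fun s₁ hf₁ hx hy => ?_))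
    (T₂ := 40 * (n + M + 1)) (fun s₁ hf₁ h₁ => ?_) (by omega)
  · have e1 : s₁.arr a_col = s.arr a_col := hf₁.arr _ rfl
    have e2 : s₁.reg r_v = v := (hf₁.reg _ rfl).trans hvr
    rcases lt_trichotomy (s₁.reg r_y) v with h | h | h
    · simp [blueNbrTest, e2, h, h.ne]
    · simp [blueNbrTest, e1, e2, h, hcol _ hx]
    · simp [blueNbrTest, e2, h, h.ne', h.not_gt]
  have hs₁ := hs.of_frame hf₁
  have hmark : ∀ x < n, s₁.arr a_mark x = if x ∈ B.filter (H.Adj v) then 1 else 0 := by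
    intro x hx
    rw [h₁ x hx]
    split_ifs with hxW
    · obtain ⟨hxB, hadj⟩ := Finset.mem_filter.1 hxW
      rw [Finset.card_eq_one]
      refine ⟨v, ?_⟩
      ext y
      simp only [Finset.mem_filter, Finset.mem_range, Finset.mem_singleton]
      constructor
      · exact fun h => h.2.2.1
      · rintro rfl
        exact ⟨hv, hadj.symm, rfl, hxB⟩
    · rw [Finset.card_eq_zero]
      refine Finset.eq_empty_of_forall_notMem fun y hy => ?_
      obtain ⟨-, hadj, rfl, hxB⟩ := by simpa only [Finset.mem_filter] using hy
      exact hxW (Finset.mem_filter.2 ⟨hxB, hadj.symm⟩)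
  refine Runs.seq (tally_runs (P := fun x y => y ∈ B.filter (H.Adj v)) isTest_markTest
    hs₁ (by decide) (by decide) (fun s₂ hf₂ hx hy => ?_))
    (T₂ := 20 * (n + M + 1)) (fun s₂ hf₂ h₂ => ?_) (by omega)
  · have e1 : s₂.arr a_mark = s₁.arr a_mark := hf₂.arr _ rfl
    simp only [markTest, run, RAMState.setReg_reg, if_true, e1, hmark _ hy]
    congr 1
  have hvr₂ : s₂.reg r_v = v := (hf₂.reg _ rfl).trans ((hf₁.reg _ rfl).trans hvr)
  have hdeg₂ : s₂.arr a_deg = s.arr a_deg := (hf₂.arr _ rfl).trans (hf₁.arr _ rfl)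
  refine Runs.seq (T₁ := 12 * (v + 1)) (T₂ := 5)
    (count_runs (P := fun u => B.filter (H.Adj v) ⊆ B.filter (H.Adj u))
    isTest_coverTest hvr₂ (Or.inr rfl) (fun s₃ hf₃ hi => ?_))
    (fun s₃ hf₃ h₃ => ?_) (by omega)
  · have e1 : s₃.arr a_hit = s₂.arr a_hit := hf₃.arr _ rfl
    have e2 : s₃.arr a_deg = s.arr a_deg := (hf₃.arr _ rfl).trans hdeg₂
    have e3 : s₃.reg r_v = v := (hf₃.reg _ rfl).trans hvr₂
    set u := s₃.reg r_i with hu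
    have key : s₂.arr a_hit u < s.arr a_deg v ↔
        ¬ B.filter (H.Adj v) ⊆ B.filter (H.Adj u) := by
      have : s₂.arr a_hit u = (B.filter (H.Adj v) ∩ B.filter (H.Adj u)).card := by
        rw [h₂ u (by omega)]
        congr 1
        ext y
        simp only [Finset.mem_filter, Finset.mem_inter, Finset.mem_range]
        constructor
        · rintro ⟨-, h1, h2⟩
          exact ⟨h2, h2.1, h1⟩
        · rintro ⟨h2, -, h1⟩
          exact ⟨by simpa using hB h2.1, h1, h2⟩
      rw [this, hdeg v hv]
      constructor
      · intro hlt hsub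
        rw [Finset.inter_eq_left.2 hsub] at hlt
        omega
      · intro hsub
        refine Finset.card_lt_card ⟨Finset.inter_subset_left, fun h => hsub fun z hz => ?_⟩
        exact (Finset.mem_inter.1 (h hz)).2
    by_cases h : B.filter (H.Adj v) ⊆ B.filter (H.Adj u)
    · simp only [coverTest, run, RAMState.setReg_reg, RAMState.setReg_arr, e1, e2, e3,
        ← hu, if_pos h]
      have h' := mt key.1 (not_not.2 h)
      simp [h']
    · simp only [coverTest, run, RAMState.setReg_reg, RAMState.setReg_arr, e1, e2, e3,
        ← hu, if_neg h]
      have h' := key.2 h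
      simp [h']
  · have e1 : s₃.arr a_col = s.arr a_col :=
      (hf₃.arr _ rfl).trans ((hf₂.arr _ rfl).trans (hf₁.arr _ rfl))
    have e2 : s₃.arr a_ret = s.arr a_ret :=
      (hf₃.arr _ rfl).trans ((hf₂.arr _ rfl).trans (hf₁.arr _ rfl))
    have e3 : s₃.reg r_v = v := (hf₃.reg _ rfl).trans hvr₂
    have key : s₃.reg r_cnt < 1 ↔ ∀ w < v, ¬ B.filter (H.Adj v) ⊆ B.filter (H.Adj w) := by
      rw [h₃, Nat.lt_one_iff, Finset.card_eq_zero, Finset.eq_empty_iff_forall_notMem]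
      simp only [Finset.mem_filter, Finset.mem_range, not_and]
    have hret : v ∈ retained H n B ↔ v ∈ B ∨ s₃.reg r_cnt < 1 := by
      rw [key]
      simp [retained, hv]
    refine Runs.of_run rfl (by simp) ?_
    ext x
    simp only [Function.update_apply, hret]
    by_cases h : s₃.reg r_cnt < 1
    · simp [h, e2, e3]
    · simp [h, e1, e2, e3, hcol v hv]

theorem retain_runs {H : SimpleGraph ℕ} {n M : ℕ} {B : Finset ℕ} {s : RAMState}
    (hs : Stored H n M s) (hB : B ⊆ Finset.range n)
    (hcol : ∀ x < n, s.arr a_col x = if x ∈ B then 1 else 0) :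
    retain.Runs s (n * (70 * (n + M + 1)) + 20 * (n + M + 1) + 2) fun s' =>
      ∀ x < n, s'.arr a_ret x = if x ∈ retained H n B then 1 else 0 := by
  classical
  refine Runs.seq (tally_runs (P := fun _ y => y ∈ B) isTest_blueTest hs
    (by decide) (by decide) (fun s₁ hf₁ hx hy => ?_))
    (T₂ := n * (70 * (n + M + 1)) + 2) (fun s₁ hf₁ h₁ => ?_) (by omega)
  · have e1 : s₁.arr a_col = s.arr a_col := hf₁.arr _ rfl
    simp [blueTest, e1, hcol _ hy]
  have hs₁ := hs.of_frame hf₁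
  have hcol₁ : s₁.arr a_col = s.arr a_col := hf₁.arr _ rfl
  have hdeg₁ : ∀ x < n, s₁.arr a_deg x = (B.filter (H.Adj x)).card := by
    intro x hx
    rw [h₁ x hx]
    congr 1
    ext y
    simp only [Finset.mem_filter]
    exact ⟨fun h => ⟨h.2.2, h.2.1⟩, fun h => ⟨hB h.1, h.2, h.1⟩⟩
  refine Runs.forLoop (fun j s' => ∀ x < j, s'.arr a_ret x = if x ∈ retained H n B then 1 else 0)
    (T := 60 * (n + M + 1)) hs₁.n_eq rfl rfl (by decide) (by decide) (by decide) (by simp)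
    (fun j hj s' hj' hf hI => ?_) (by gcongr; omega) (fun s' _ h => h)
  have e1 : s'.arr a_col = s.arr a_col := (hf.arr _ rfl).trans hcol₁
  have e2 : s'.arr a_deg = s₁.arr a_deg := hf.arr _ rfl
  refine (retainStep_runs (B := B) (hs₁.of_frame hf) hB (by rw [e1]; exact hcol)
    (by rw [e2]; exact hdeg₁) hj hj').mono le_rfl fun s'' _ h x hx => ?_
  simp only [RAMState.setReg_arr, h, Function.update_apply]
  by_cases hxj : x = j
  · simp [hxj]
  · simpa [hxj] using hI x (by omega)

/-! ### The output -/

/-- Number the retained vertices consecutively. -/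
def number : RAMProg :=
  .const r_cnt 0 ;; forLoop r_i r_n
    (.store a_id r_i r_cnt ;; .load r_f a_ret r_i ;; .add r_cnt r_cnt r_f)

theorem number_runs {n : ℕ} {R : Finset ℕ} {s : RAMState} (hn : s.reg r_n = n)
    (hR : R ⊆ Finset.range n) (hret : ∀ x < n, s.arr a_ret x = if x ∈ R then 1 else 0) :
    number.Runs s (n * 6 + 3) fun s' => s'.reg r_cnt = R.card ∧
      ∀ x < n, s'.arr a_id x = (R.filter (· < x)).card := by
  refine Runs.seq (T₁ := 1) (T₂ := n * 6 + 2) (R := fun s' => s' = s.setReg r_cnt 0)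
    (Runs.of_run rfl le_rfl rfl) (fun s₁ _ h₁ => ?_) (by omega)
  subst h₁
  refine Runs.forLoop (fun j s' => s'.reg r_cnt = (R.filter (· < j)).card ∧
    ∀ x < j, s'.arr a_id x = (R.filter (· < x)).card) (T := 3) (n := n)
    (by simpa using hn) rfl rfl (by decide) (by decide) (by decide) (by simp)
    (fun j hj s' hj' hf hI => ?_) le_rfl (fun s' _ h => ?_)
  · have e : s'.arr a_ret = s.arr a_ret := by rw [hf.arr _ rfl]; simp
    have hcard : (R.filter (· < j + 1)).card =
        (R.filter (· < j)).card + if j ∈ R then 1 else 0 := by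
      split_ifs with hjR
      · rw [← Finset.card_insert_of_notMem (a := j) (by simp)]
        congr 1
        ext x
        simp only [Finset.mem_filter, Finset.mem_insert]
        constructor
        · rintro ⟨hx, hlt⟩
          by_cases h : x = j
          · exact Or.inl h
          · exact Or.inr ⟨hx, by omega⟩
        · rintro (rfl | ⟨hx, hlt⟩)
          · exact ⟨hjR, by omega⟩
          · exact ⟨hx, by omega⟩
      · rw [add_zero]
        congr 1
        refine Finset.filter_congr fun x hx => ?_
        have : x ≠ j := fun h => hjR (h ▸ hx)
        omega
    refine Runs.of_run rfl le_rfl ⟨?_, fun x hx => ?_⟩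
    · rw [hcard]
      simp [hj', hI.1, e, hret j hj]
    · by_cases hxj : x = j
      · simp [hxj, hj', hI.1]
      · simpa [hxj, hj'] using hI.2 x (by omega)
  · have : R.filter (· < n) = R :=
      Finset.filter_true_of_mem fun x hx => by simpa using hR hx
    exact ⟨by rw [h.1, this], h.2⟩

/-- The numbers of the ends of those edges `(S i, T i)`, `i < j`, that have both ends in `R`. -/
def numberedEdges (S T ν : ℕ → ℕ) (R : Finset ℕ) (j : ℕ) : List (ℕ × ℕ) :=
  ((List.range j).filter fun i => S i ∈ R ∧ T i ∈ R).map fun i => (ν (S i), ν (T i))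

/-- Write the retained edges to the output. -/
def emitEdges : RAMProg :=
  .const r_len 3 ;; .const r_flag 0 ;; forLoop r_i r_m (
    .load r_x a_src r_i ;; .load r_y a_tgt r_i ;; .load r_a a_ret r_x ;; .load r_b a_ret r_y ;;
    .const r_f 0 ;; .ifLt r_f r_a (.ifLt r_f r_b (
      .load r_a a_id r_x ;; .store a_out r_len r_a ;; .const r_f 1 ;; .add r_len r_len r_f ;;
      .load r_a a_id r_y ;; .store a_out r_len r_a ;; .add r_len r_len r_f ;;
      .add r_flag r_flag r_f) .skip) .skip)

/-- The pairs of `L` are written to the output, from position `3` on. -/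
structure Emitted (L : List (ℕ × ℕ)) (s : RAMState) : Prop where
  length_eq : s.reg r_flag = L.length
  fst_eq : ∀ i (hi : i < L.length), s.arr a_out (3 + 2 * i) = L[i].1
  snd_eq : ∀ i (hi : i < L.length), s.arr a_out (3 + (2 * i + 1)) = L[i].2

theorem emitEdges_runs {n m : ℕ} {R : Finset ℕ} {S T ν : ℕ → ℕ} {s : RAMState}
    (hm : s.reg r_m = m) (hS : s.arr a_src = S) (hT : s.arr a_tgt = T)
    (hSn : ∀ i < m, S i < n) (hTn : ∀ i < m, T i < n)
    (hret : ∀ x < n, s.arr a_ret x = if x ∈ R then 1 else 0)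
    (hid : ∀ x < n, s.arr a_id x = ν x) :
    emitEdges.Runs s (m * 18 + 4) (Emitted (numberedEdges S T ν R m)) := by
  refine Runs.seq (T₁ := 1) (T₂ := m * 18 + 3) (R := fun s' => s' = s.setReg r_len 3)
    (Runs.of_run rfl le_rfl rfl) (fun s₁ _ h₁ => ?_) (by omega)
  refine Runs.seq (T₁ := 1) (T₂ := m * 18 + 2) (R := fun s' => s' = s₁.setReg r_flag 0)
    (Runs.of_run rfl le_rfl rfl) (fun s₂ _ h₂ => ?_) (by omega)
  subst h₁
  subst h₂
  refine Runs.forLoop (fun j s' => Emitted (numberedEdges S T ν R j) s' ∧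
      s'.reg r_len = 3 + 2 * (numberedEdges S T ν R j).length) (T := 15) (n := m)
    (by simpa using hm) rfl rfl (by decide) (by decide) (by decide)
    ⟨⟨by simp [numberedEdges], by simp [numberedEdges], by simp [numberedEdges]⟩,
      by simp [numberedEdges]⟩
    (fun j hj s' hj' hf hI => ?_) le_rfl (fun s' _ h => h.1)
  have e1 : s'.arr a_src = S := by rw [hf.arr _ rfl]; simpa using hS
  have e2 : s'.arr a_tgt = T := by rw [hf.arr _ rfl]; simpa using hT
  have e3 : s'.arr a_ret = s.arr a_ret := by rw [hf.arr _ rfl]; simp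
  have e4 : s'.arr a_id = s.arr a_id := by rw [hf.arr _ rfl]; simp
  have e5 := hid _ (hSn j hj)
  have e6 := hid _ (hTn j hj)
  have hsucc : numberedEdges S T ν R (j + 1) = numberedEdges S T ν R j ++
      if S j ∈ R ∧ T j ∈ R then [(ν (S j), ν (T j))] else [] := by
    by_cases h : S j ∈ R ∧ T j ∈ R <;>
      simp [numberedEdges, List.range_succ, List.filter_append, h]
  obtain ⟨hE, hlen⟩ := hI
  refine Runs.of_run rfl (by simp) ?_
  rw [hsucc]
  generalize numberedEdges S T ν R j = L at *
  have hrS := hret _ (hSn j hj)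
  have hrT := hret _ (hTn j hj)
  by_cases hx : S j ∈ R
  · rw [if_pos hx] at hrS
    by_cases hy : T j ∈ R
    · rw [if_pos hy] at hrT
      simp only [hx, hy, and_self, if_true]
      have hr : ∀ i, i < (L ++ [(ν (S j), ν (T j))]).length → i < L.length ∨ i = L.length := by
        intro i hi
        simp at hi
        omega
      refine ⟨⟨?_, fun i hi => ?_, fun i hi => ?_⟩, ?_⟩
      · simp [e1, e2, e3, hj', hrS, hrT, hE.length_eq]
      · rcases hr i hi with h | rfl
        · have h2 : 3 + 2 * i ≠ 3 + 2 * L.length + 1 := by omega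
          simp [e1, e2, e3, hj', hrS, hrT, hlen, ← hE.fst_eq i h, h2, h, h.ne]
        · simp [e1, e2, e3, e4, e5, hj', hrS, hrT, hlen]
      · rcases hr i hi with h | rfl
        · have h2 : 3 + (2 * i + 1) ≠ 3 + 2 * L.length + 1 := by omega
          simp [e1, e2, e3, hj', hrS, hrT, hlen, ← hE.snd_eq i h, h2, h]
          omega
        · simp [e1, e2, e3, e4, e6, hj', hrS, hrT, hlen, add_assoc]
      · simp [e1, e2, e3, hj', hrS, hrT, hlen]
        ring
    · rw [if_neg hy] at hrT
      simp only [hy, and_false, if_false, List.append_nil]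
      refine ⟨⟨?_, ?_, ?_⟩, ?_⟩
      · simpa [e1, e2, e3, hj', hrS, hrT] using hE.length_eq
      · simpa [e1, e2, e3, hj', hrS, hrT] using hE.fst_eq
      · simpa [e1, e2, e3, hj', hrS, hrT] using hE.snd_eq
      · simpa [e1, e2, e3, hj', hrS, hrT] using hlen
  · rw [if_neg hx] at hrS
    simp only [hx, false_and, if_false, List.append_nil]
    refine ⟨⟨?_, ?_, ?_⟩, ?_⟩
    · simpa [e1, e2, e3, hj', hrS] using hE.length_eq
    · simpa [e1, e2, e3, hj', hrS] using hE.fst_eq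
    · simpa [e1, e2, e3, hj', hrS] using hE.snd_eq
    · simpa [e1, e2, e3, hj', hrS] using hlen

end RAMProg

namespace RAMProg

/-! ### The input -/

/-- The edges of `H` are the pairs `{S i, T i}`, each listed exactly once. -/
structure EdgeList (H : SimpleGraph ℕ) (n m : ℕ) (S T : ℕ → ℕ) : Prop where
  src_lt : ∀ i < m, S i < n
  tgt_lt : ∀ i < m, T i < n
  adj_iff : ∀ x y, H.Adj x y ↔ ∃ i < m, s(S i, T i) = s(x, y)
  inj : ∀ i < m, ∀ j < m, s(S i, T i) = s(S j, T j) → i = j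

/-- The edges followed by the reversed edges. -/
structure Doubled (m : ℕ) (S T S' T' : ℕ → ℕ) (j : ℕ) : Prop where
  src : ∀ i < j, S' i = S i
  tgt : ∀ i < j, T' i = T i
  src_add : ∀ i < j, S' (i + m) = T i
  tgt_add : ∀ i < j, T' (i + m) = S i

theorem EdgeList.arcs {H : SimpleGraph ℕ} {n m : ℕ} {S T S' T' : ℕ → ℕ}
    (h : EdgeList H n m S T) (h' : Doubled m S T S' T' m) : Arcs H n (m + m) S' T' := by
  have hcases : ∀ i < m + m, (i < m ∧ S' i = S i ∧ T' i = T i) ∨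
      ∃ j < m, i = j + m ∧ S' i = T j ∧ T' i = S j := by
    intro i hi
    by_cases him : i < m
    · exact Or.inl ⟨him, h'.src i him, h'.tgt i him⟩
    · obtain ⟨j, rfl⟩ := Nat.exists_eq_add_of_le (not_lt.1 him)
      rw [add_comm m j]
      exact Or.inr ⟨j, by omega, rfl, h'.src_add j (by omega), h'.tgt_add j (by omega)⟩
  have hne : ∀ i < m, S i ≠ T i := fun i hi he =>
    H.irrefl ((h.adj_iff (S i) (S i)).2 ⟨i, hi, by rw [← he]⟩)
  refine ⟨fun x y hxy => ?_, fun x y => ?_, fun i hi j hj hS hT => ?_⟩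
  · obtain ⟨i, hi, he⟩ := (h.adj_iff x y).1 hxy
    have h1 := h.src_lt i hi
    have h2 := h.tgt_lt i hi
    rcases Sym2.eq_iff.1 he with ⟨rfl, rfl⟩ | ⟨rfl, rfl⟩
    · exact ⟨h1, h2⟩
    · exact ⟨h2, h1⟩
  · rw [h.adj_iff]
    constructor
    · rintro ⟨i, hi, he⟩
      rcases Sym2.eq_iff.1 he with ⟨rfl, rfl⟩ | ⟨rfl, rfl⟩
      · exact ⟨i, by omega, h'.src i hi, h'.tgt i hi⟩
      · exact ⟨i + m, by omega, h'.src_add i hi, h'.tgt_add i hi⟩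
    · rintro ⟨i, hi, rfl, rfl⟩
      rcases hcases i hi with ⟨him, h1, h2⟩ | ⟨j, hj, -, h1, h2⟩
      · exact ⟨i, him, by rw [h1, h2]⟩
      · exact ⟨j, hj, by rw [h1, h2, Sym2.eq_swap]⟩
  · rcases hcases i hi with ⟨him, h1, h2⟩ | ⟨i', hi', rfl, h1, h2⟩ <;>
      rcases hcases j hj with ⟨hjm, h3, h4⟩ | ⟨j', hj', rfl, h3, h4⟩ <;>
      rw [h1, h3] at hS <;> rw [h2, h4] at hT
    · exact h.inj i him j hjm (by rw [hS, hT])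
    · have := h.inj i him j' hj' (by rw [hS, hT, Sym2.eq_swap])
      subst this
      exact absurd hS (hne i him)
    · have := h.inj i' hi' j hjm (by rw [hS, hT, Sym2.eq_swap])
      subst this
      exact absurd hS.symm (hne i' hi')
    · rw [h.inj i' hi' j' hj' (by rw [hS, hT])]

/-- Read the input and list the arcs of the graph. -/
def loadInput : RAMProg :=
  (.const r_a 0 ;; .load r_n a_in r_a ;; .const r_a 1 ;; .load r_k a_in r_a ;; .const r_a 2 ;;
    .load r_m a_in r_a ;; .add r_arcs r_m r_m ;; .const 0 0 ;;
    .ifLt r_n r_k (.add r_k r_n 0) .skip ;; .const r_len 3) ;;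
  forLoop r_i r_m (.load r_x a_in r_len ;; .const r_a 1 ;; .add r_len r_len r_a ;;
    .load r_y a_in r_len ;; .add r_len r_len r_a ;; .add r_b r_i r_m ;;
    .store a_src r_i r_x ;; .store a_tgt r_i r_y ;; .store a_src r_b r_y ;; .store a_tgt r_b r_x)

/-- The graph and the parameter are in the input array. -/
structure Input (n k m : ℕ) (S T : ℕ → ℕ) (s : RAMState) : Prop where
  n_eq : s.arr a_in 0 = n
  k_eq : s.arr a_in 1 = k
  m_eq : s.arr a_in 2 = m
  src_eq : ∀ i < m, s.arr a_in (3 + 2 * i) = S i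
  tgt_eq : ∀ i < m, s.arr a_in (3 + (2 * i + 1)) = T i

theorem loadInput_runs {n k m : ℕ} {S T : ℕ → ℕ} {s : RAMState} (hs : Input n k m S T s) :
    loadInput.Runs s (m * 13 + 13) fun s' => s'.reg r_n = n ∧ s'.reg r_k = min k n ∧
      s'.reg r_m = m ∧ s'.reg r_arcs = m + m ∧
      Doubled m S T (s'.arr a_src) (s'.arr a_tgt) m := by
  refine Runs.seq (T₁ := 11) (T₂ := m * 13 + 2) (R := fun s' => s'.reg r_n = n ∧
    s'.reg r_k = min k n ∧ s'.reg r_m = m ∧ s'.reg r_arcs = m + m ∧ s'.reg r_len = 3)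
    (Runs.of_run rfl le_rfl ?_) (fun s₁ hf₁ h₁ => ?_) (by omega)
  · by_cases h : n < k
    · simp [hs.n_eq, hs.k_eq, hs.m_eq, h, h.le]
    · simp [hs.n_eq, hs.k_eq, hs.m_eq, h]
      omega
  obtain ⟨hn, hk, hm, hM, hlen⟩ := h₁
  have hin : s₁.arr a_in = s.arr a_in := hf₁.arr _ rfl
  refine Runs.forLoop (fun j s' => Doubled m S T (s'.arr a_src) (s'.arr a_tgt) j ∧
    s'.reg r_len = 3 + 2 * j) (T := 10) hm rfl rfl (by decide) (by decide) (by decide)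
    ⟨⟨by simp, by simp, by simp, by simp⟩, by simpa using hlen⟩
    (fun j hj s' hj' hf hI => ?_) le_rfl (fun s' hf h => ?_)
  · obtain ⟨hD, hlen'⟩ := hI
    have hin' : s'.arr a_in = s.arr a_in := (hf.arr _ rfl).trans hin
    have hm' : s'.reg r_m = m := (hf.reg _ rfl).trans hm
    have h1 := hs.src_eq j hj
    have h2 := hs.tgt_eq j hj
    rw [← add_assoc] at h2
    refine Runs.of_run rfl le_rfl ⟨⟨fun i hi => ?_, fun i hi => ?_, fun i hi => ?_,
      fun i hi => ?_⟩, by simp [hlen']; ring⟩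
    · have h3 : i ≠ j + m := by omega
      by_cases hij : i = j
      · subst hij
        simp [hin', hm', hj', hlen', h1, (Nat.zero_le _).trans_lt hj |>.ne']
      · simpa [hin', hm', hj', h3, hij] using hD.src i (by omega)
    · have h3 : i ≠ j + m := by omega
      by_cases hij : i = j
      · subst hij
        simp [hin', hm', hj', hlen', h2, (Nat.zero_le _).trans_lt hj |>.ne']
      · simpa [hin', hm', hj', h3, hij] using hD.tgt i (by omega)
    · have h3 : i + m ≠ j := by omega
      by_cases hij : i = j
      · subst hij
        simp [hin', hm', hj', hlen', h2]
      · simpa [hin', hm', hj', h3, hij] using hD.src_add i (by omega)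
    · have h3 : i + m ≠ j := by omega
      by_cases hij : i = j
      · subst hij
        simp [hin', hm', hj', hlen', h1]
      · simpa [hin', hm', hj', h3, hij] using hD.tgt_add i (by omega)
  · exact ⟨(hf.reg _ rfl).trans hn, (hf.reg _ rfl).trans hk, (hf.reg _ rfl).trans hm,
      (hf.reg _ rfl).trans hM, h.1⟩

/-! ### The whole program -/

/-- Write the first three entries of the output. -/
def emitHeader : RAMProg :=
  .const r_a 0 ;; .store a_out r_a r_cnt ;; .const r_a 1 ;; .store a_out r_a r_k ;;
    .const r_a 2 ;; .store a_out r_a r_flag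

/-- The kernelization program. -/
def kernelize (d : ℕ) : RAMProg :=
  loadInput ;; rank d ;; caps d ;; color d ;; retain ;; number ;; emitEdges ;; emitHeader

/-- The output array holds the header and the pairs of `L`. -/
structure Output (n k : ℕ) (L : List (ℕ × ℕ)) (s : RAMState) : Prop where
  n_eq : s.arr a_out 0 = n
  k_eq : s.arr a_out 1 = k
  m_eq : s.arr a_out 2 = L.length
  fst_eq : ∀ i (hi : i < L.length), s.arr a_out (3 + 2 * i) = L[i].1
  snd_eq : ∀ i (hi : i < L.length), s.arr a_out (3 + (2 * i + 1)) = L[i].2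

theorem kernelize_runs {H : SimpleGraph ℕ} {n k m d : ℕ} {S T : ℕ → ℕ} {s : RAMState}
    (hE : EdgeList H n m S T) (hdeg : DegenerateOn H (Finset.range n) d)
    (hs : Input n k m S T s) (h0 : ∀ A, A ≠ a_in → ∀ i, s.arr A i = 0) :
    (kernelize d).Runs s (n * (2 ^ d * (220 * (n + (m + m) + 1))) + 20 * (n + (m + m) + 1) +
      31 * m + 6 * n + (d + 1) * (4 * n + 10) + 36) fun s' =>
      ∃ (pos : ℕ → ℕ) (B : Finset ℕ), IsRanking H n d pos ∧ B ⊆ Finset.range n ∧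
        Sparse H n d (min k n) pos B ∧
        (∀ w < n, w ∉ B → Saturated H n d (min k n) pos B w) ∧
        Output (retained H n B).card (min k n) (numberedEdges S T
          (fun x => ((retained H n B).filter (· < x)).card) (retained H n B) m) s' := by
  set M := m + m with hM
  set c := min k n with hc
  have hcn : c ≤ n := min_le_right _ _
  have hT₁ : n * (40 * (n + M + 1)) ≤ n * (2 ^ d * (40 * (n + M + 1))) :=
    Nat.mul_le_mul_left _ (Nat.le_mul_of_pos_left _ (by positivity))
  have hT₂ : n * (70 * (n + M + 1)) ≤ n * (2 ^ d * (70 * (n + M + 1))) :=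
    Nat.mul_le_mul_left _ (Nat.le_mul_of_pos_left _ (by positivity))
  have hT₃ : n * (2 ^ d * (220 * (n + M + 1))) = n * (2 ^ d * (40 * (n + M + 1))) +
      n * (2 ^ d * (110 * (n + M + 1))) + n * (2 ^ d * (70 * (n + M + 1))) := by ring
  have hT₄ : (d + 1) * (4 * c + 10) ≤ (d + 1) * (4 * n + 10) := by gcongr
  refine Runs.seq (loadInput_runs hs) (fun s₁ hf₁ h₁ => ?_)
    (T₂ := n * (40 * (n + M + 1)) + 2 + ((d + 1) * (4 * c + 10) + 4 +
      (n * (2 ^ d * (110 * (n + M + 1))) + 2 + (n * (70 * (n + M + 1)) + 20 * (n + M + 1) + 2 +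
        (n * 6 + 3 + (m * 18 + 4 + 6)))))) (by omega)
  obtain ⟨hn₁, hk₁, hm₁, hM₁, hD₁⟩ := h₁
  have hs₁ : Stored H n M s₁ := ⟨hn₁, hM₁, hE.arcs hD₁⟩
  refine Runs.seq (rank_runs hs₁ hdeg fun v => ?_) (fun s₂ hf₂ hpos => ?_) le_rfl
  · rw [hf₁.arr _ rfl]
    exact h0 _ (by decide) _
  have hs₂ := hs₁.of_frame hf₂
  have hk₂ : s₂.reg r_k = c := (hf₂.reg _ rfl).trans hk₁
  refine Runs.seq (caps_runs hk₂ ?_) (fun s₃ hf₃ hcap => ?_) le_rfl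
  · rw [hf₂.arr _ rfl, hf₁.arr _ rfl]
    exact h0 _ (by decide) _
  have hs₃ := hs₂.of_frame hf₃
  have hpos₃ : s₃.arr a_pos = s₂.arr a_pos := hf₃.arr _ rfl
  refine Runs.seq (color_runs (k := c) (pos := s₂.arr a_pos) ⟨hs₃, hpos₃, ?_, hcap⟩ hpos ?_)
    (fun s₄ hf₄ h₄ => ?_) le_rfl
  · intro x _
    rw [hf₃.arr _ rfl, hf₂.arr _ rfl, hf₁.arr _ rfl]
    simpa using h0 _ (by decide) x
  · intro x _
    rw [hf₃.arr _ rfl, hf₂.arr _ rfl, hf₁.arr _ rfl]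
    exact h0 _ (by decide) x
  obtain ⟨B, hB, hpB, hsp, hsat⟩ := h₄
  set R := retained H n B with hR
  have wr : ∀ r, r ∉ [0, r_i, r_x, r_y, r_f, r_a, r_b, r_cnt, r_size, r_flag, r_len] → r ≠ r_v →
      (color d).writesReg r = false := fun r hr hv => by
    simp only [color, forLoop_writesReg, colorStep_writesReg d hr]
    simp at hr ⊢
    omega
  have wa : ∀ A, A ∉ [a_hit, a_mark, a_list, a_col] → (color d).writesArr A = false :=
    fun A hA => by simp only [color, forLoop_writesArr, colorStep_writesArr d hA]
  refine Runs.seq (retain_runs hpB.stored hB hpB.col_eq) (fun s₅ hf₅ hret => ?_) le_rfl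
  have hs₅ := hpB.stored.of_frame hf₅
  refine Runs.seq (number_runs hs₅.n_eq (Finset.filter_subset _ _) hret)
    (fun s₆ hf₆ h₆ => ?_) le_rfl
  obtain ⟨hcnt, hid⟩ := h₆
  have hm₆ : s₆.reg r_m = m := by
    rw [hf₆.reg _ rfl, hf₅.reg _ rfl, hf₄.reg _ (wr _ (by decide) (by decide)), hf₃.reg _ rfl,
      hf₂.reg _ rfl, hm₁]
  have hk₆ : s₆.reg r_k = c := by
    rw [hf₆.reg _ rfl, hf₅.reg _ rfl, hf₄.reg _ (wr _ (by decide) (by decide)), hf₃.reg _ rfl, hk₂]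
  have hS₆ : s₆.arr a_src = s₁.arr a_src := by
    rw [hf₆.arr _ rfl, hf₅.arr _ rfl, hf₄.arr _ (wa _ (by decide)), hf₃.arr _ rfl, hf₂.arr _ rfl]
  have hT₆ : s₆.arr a_tgt = s₁.arr a_tgt := by
    rw [hf₆.arr _ rfl, hf₅.arr _ rfl, hf₄.arr _ (wa _ (by decide)), hf₃.arr _ rfl, hf₂.arr _ rfl]
  have hret₆ : s₆.arr a_ret = s₅.arr a_ret := hf₆.arr _ rfl
  refine Runs.seq (emitEdges_runs (n := n) (R := R)
    (ν := fun x => (R.filter (· < x)).card) hm₆ hS₆ hT₆ ?_ ?_ (by rw [hret₆]; exact hret) hid)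
    (fun s₇ hf₇ h₇ => ?_) le_rfl
  · intro i hi
    rw [hD₁.src i hi]
    exact hE.src_lt i hi
  · intro i hi
    rw [hD₁.tgt i hi]
    exact hE.tgt_lt i hi
  have hL : numberedEdges (s₁.arr a_src) (s₁.arr a_tgt) (fun x => (R.filter (· < x)).card) R m =
      numberedEdges S T (fun x => (R.filter (· < x)).card) R m := by
    unfold numberedEdges
    have h1 : ((List.range m).filter fun i => s₁.arr a_src i ∈ R ∧ s₁.arr a_tgt i ∈ R) =
        (List.range m).filter fun i => S i ∈ R ∧ T i ∈ R :=
      List.filter_congr fun i hi => by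
        rw [hD₁.src i (List.mem_range.1 hi), hD₁.tgt i (List.mem_range.1 hi)]
    rw [h1]
    refine List.map_congr_left fun i hi => ?_
    have := List.mem_range.1 (List.mem_filter.1 hi).1
    rw [hD₁.src i this, hD₁.tgt i this]
  rw [hL] at h₇
  have hcnt₇ : s₇.reg r_cnt = R.card := (hf₇.reg _ rfl).trans hcnt
  have hk₇ : s₇.reg r_k = c := (hf₇.reg _ rfl).trans hk₆
  refine Runs.of_run rfl le_rfl ⟨s₂.arr a_pos, B, hpos, hB, hsp, hsat, ?_⟩
  refine ⟨by simp [emitHeader, hcnt₇, ← hR], by simp [emitHeader, hk₇],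
    by simp [emitHeader, h₇.length_eq, ← hR], fun i hi => ?_, fun i hi => ?_⟩
  · have h1 : 3 + 2 * i ≠ 0 := by omega
    have h2 : 3 + 2 * i ≠ 1 := by omega
    have h3 : 3 + 2 * i ≠ 2 := by omega
    simp only [emitHeader, run, RAMState.setArr_arr_self, RAMState.setReg_reg, RAMState.setReg_arr,
      RAMState.setArr_reg, if_true]
    rw [if_neg h3, if_neg h2, if_neg h1]
    exact h₇.fst_eq i hi
  · have h1 : 3 + (2 * i + 1) ≠ 0 := by omega
    have h2 : 3 + (2 * i + 1) ≠ 1 := by omega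
    have h3 : 3 + (2 * i + 1) ≠ 2 := by omega
    simp only [emitHeader, run, RAMState.setArr_arr_self, RAMState.setReg_reg, RAMState.setReg_arr,
      RAMState.setArr_reg, if_true]
    rw [if_neg h3, if_neg h2, if_neg h1]
    exact h₇.snd_eq i hi

end RAMProg

open RAMProg

/-! ### Words -/

theorem getD_flatMap_pair {α : Type*} (g : α → ℕ) (l : List (α × α)) (i : ℕ) (hi : i < l.length) :
    (l.flatMap fun e => [g e.1, g e.2]).getD (2 * i) 0 = g l[i].1 ∧
      (l.flatMap fun e => [g e.1, g e.2]).getD (2 * i + 1) 0 = g l[i].2 := by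
  induction l generalizing i with
  | nil => simp at hi
  | cons e l ih =>
    cases i with
    | zero => simp
    | succ i => simpa [mul_add, add_right_comm] using ih i (by simpa using hi)

theorem eq_getElem_flatMap_pair {α : Type*} (g : α → ℕ) (l : List (α × α)) (f : ℕ → ℕ)
    (hf : ∀ i (hi : i < l.length), f (2 * i) = g l[i].1 ∧ f (2 * i + 1) = g l[i].2) (i : ℕ)
    (hi : i < (l.flatMap fun e => [g e.1, g e.2]).length) :
    f i = (l.flatMap fun e => [g e.1, g e.2])[i] := by
  induction l generalizing i f with
  | nil => simp at hi
  | cons e l ih =>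
    match i with
    | 0 => exact (hf 0 (by simp)).1
    | 1 => exact (hf 0 (by simp)).2
    | i + 2 =>
      have := ih (fun j => f (j + 2)) (fun j hj =>
        hf (j + 1) (by simpa using hj)) i (by simpa using hi)
      simpa using this

theorem ncard_edgeSet_eq_length {n : ℕ} {G : SimpleGraph (Fin n)} {l : List (Fin n × Fin n)}
    (hnd : (l.map fun e => s(e.1, e.2)).Nodup)
    (hmem : ∀ e : Sym2 (Fin n), e ∈ G.edgeSet ↔ e ∈ l.map fun e => s(e.1, e.2)) :
    G.edgeSet.ncard = l.length := by
  classical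
  have : G.edgeSet = ((l.map fun e => s(e.1, e.2)).toFinset : Set (Sym2 (Fin n))) := by
    ext e
    rw [hmem]
    simp
  rw [this, Set.ncard_coe_finset, List.toFinset_card_of_nodup hnd, List.length_map]

theorem map_val_adj {n : ℕ} (G : SimpleGraph (Fin n)) (x y : ℕ) :
    (G.map Fin.valEmbedding).Adj x y ↔ ∃ u v : Fin n, G.Adj u v ∧ (u : ℕ) = x ∧ (v : ℕ) = y :=
  SimpleGraph.map_adj Fin.valEmbedding G x y

theorem DegenerateOn.map_val {n d : ℕ} {G : SimpleGraph (Fin n)}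
    (h : DegenerateOn G Finset.univ d) :
    DegenerateOn (G.map Fin.valEmbedding) (Finset.range n) d := by
  classical
  intro A hA hne
  obtain ⟨a, ha⟩ := hne
  have han : a < n := by simpa using hA ha
  obtain ⟨v, hv, hd⟩ := h (Finset.univ.filter fun u : Fin n => (u : ℕ) ∈ A)
    (Finset.subset_univ _) ⟨⟨a, han⟩, by simpa using ha⟩
  refine ⟨v, by simpa using hv, ?_⟩
  rw [← Finset.card_map Fin.valEmbedding] at hd
  refine le_trans (Finset.card_le_card fun y hy => ?_) hd
  simp only [Finset.mem_filter, map_val_adj] at hy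
  obtain ⟨hyA, u, w, huw, hu, rfl⟩ := hy
  have : u = v := Fin.ext hu
  subst this
  simp only [Finset.mem_map, Finset.mem_filter, Finset.mem_univ, true_and]
  exact ⟨w, ⟨hyA, huw⟩, rfl⟩

theorem edgeList_of_encodes {n : ℕ} {G : SimpleGraph (Fin n)} {l : List (Fin n × Fin n)}
    {S T : ℕ → ℕ} (hnd : (l.map fun e => s(e.1, e.2)).Nodup)
    (hmem : ∀ e : Sym2 (Fin n), e ∈ G.edgeSet ↔ e ∈ l.map fun e => s(e.1, e.2))
    (hS : ∀ i (hi : i < l.length), S i = l[i].1) (hT : ∀ i (hi : i < l.length), T i = l[i].2) :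
    EdgeList (G.map Fin.valEmbedding) n l.length S T := by
  have hval : ∀ i (hi : i < l.length), s(S i, T i) = Sym2.map Fin.val s(l[i].1, l[i].2) :=
    fun i hi => by rw [hS i hi, hT i hi, Sym2.map_mk]
  have hinj : Function.Injective (Sym2.map (Fin.val (n := n))) :=
    Sym2.map.injective Fin.val_injective
  refine ⟨fun i hi => by rw [hS i hi]; exact l[i].1.2, fun i hi => by rw [hT i hi]; exact l[i].2.2,
    fun x y => ?_, fun i hi j hj h => ?_⟩
  · rw [map_val_adj]
    constructor
    · rintro ⟨u, v, huv, rfl, rfl⟩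
      obtain ⟨e, he, heq⟩ := List.mem_map.1 ((hmem s(u, v)).1 huv)
      obtain ⟨i, hi, rfl⟩ := List.getElem_of_mem he
      exact ⟨i, hi, by rw [hval i hi, heq]; rfl⟩
    · rintro ⟨i, hi, h⟩
      have hadj : G.Adj l[i].1 l[i].2 :=
        (hmem _).2 (List.mem_map.2 ⟨l[i], List.getElem_mem hi, rfl⟩)
      rw [hS i hi, hT i hi] at h
      rcases Sym2.eq_iff.1 h with ⟨rfl, rfl⟩ | ⟨rfl, rfl⟩
      · exact ⟨_, _, hadj, rfl, rfl⟩
      · exact ⟨_, _, hadj.symm, rfl, rfl⟩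
  · rw [hval i hi, hval j hj] at h
    have h' := hinj h
    refine (List.Nodup.getElem_inj_iff hnd (hi := by simpa using hi) (hj := by simpa using hj)).1 ?_
    simpa using h'

/-- The induced subgraph on `R`, with the vertices numbered in increasing order. -/
noncomputable def numberedGraph (H : SimpleGraph ℕ) (R : Finset ℕ) : SimpleGraph (Fin R.card) :=
  H.comap (R.orderEmbOfFin rfl)

theorem card_filter_lt_orderEmbOfFin (R : Finset ℕ) (i : Fin R.card) :
    (R.filter (· < R.orderEmbOfFin rfl i)).card = i := by
  have : R.filter (· < R.orderEmbOfFin rfl i) =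
      (Finset.Iio i).map (R.orderEmbOfFin rfl).toEmbedding := by
    ext x
    simp only [Finset.mem_filter, Finset.mem_map, Finset.mem_Iio]
    constructor
    · rintro ⟨hx, hlt⟩
      have : x ∈ Set.range (R.orderEmbOfFin rfl) := by
        rw [Finset.range_orderEmbOfFin]
        exact hx
      obtain ⟨j, rfl⟩ := this
      exact ⟨j, by simpa using hlt, rfl⟩
    · rintro ⟨j, hj, rfl⟩
      exact ⟨Finset.orderEmbOfFin_mem _ _ _, by simpa using hj⟩
  rw [this, Finset.card_map, Fin.card_Iio]

theorem mem_iff_exists_orderEmbOfFin (R : Finset ℕ) (x : ℕ) :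
    x ∈ R ↔ ∃ i, R.orderEmbOfFin rfl i = x := by
  rw [← Finset.mem_coe, ← Finset.range_orderEmbOfFin R rfl, Set.mem_range]

theorem encodes_numberedGraph {H : SimpleGraph ℕ} {n m k : ℕ} {S T : ℕ → ℕ} {R : Finset ℕ}
    (hE : EdgeList H n m S T) :
    EncodesInstance (numberedGraph H R) k (R.card :: k ::
      (numberedEdges S T (fun x => (R.filter (· < x)).card) R m).length ::
      (numberedEdges S T (fun x => (R.filter (· < x)).card) R m).flatMap
        fun e => [e.1, e.2]) := by
  classical
  set f := R.orderEmbOfFin rfl with hf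
  set idx := (List.range m).filter fun i => S i ∈ R ∧ T i ∈ R with hidx
  have hmemidx : ∀ i, i ∈ idx ↔ i < m ∧ S i ∈ R ∧ T i ∈ R := fun i => by simp [hidx]
  have hex : ∀ x : {x // x ∈ R}, ∃ i, f i = x := fun x =>
    (mem_iff_exists_orderEmbOfFin R x).1 x.2
  choose g hg using hex
  have hgval : ∀ x : {x // x ∈ R}, (R.filter (· < (x : ℕ))).card = g x := fun x => by
    have := card_filter_lt_orderEmbOfFin R (g x)
    rwa [← hf, hg x] at this
  set l : List (Fin R.card × Fin R.card) :=
    idx.attach.map fun i : {i // i ∈ idx} =>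
      (g ⟨S i, ((hmemidx i).1 i.2).2.1⟩, g ⟨T i, ((hmemidx i).1 i.2).2.2⟩)
    with hl
  have hlval : numberedEdges S T (fun x => (R.filter (· < x)).card) R m =
      l.map fun e => ((e.1 : ℕ), (e.2 : ℕ)) := by
    rw [hl, List.map_map]
    simp only [numberedEdges, ← hidx]
    conv_lhs => rw [← List.attach_map_subtype_val idx, List.map_map]
    refine List.map_congr_left fun i _ => ?_
    simp only [Function.comp_apply]
    rw [← hgval, ← hgval]
  have hlsym : (l.map fun e => s(e.1, e.2)).map (Sym2.map f) = idx.map fun i => s(S i, T i) := by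
    rw [hl, List.map_map, List.map_map]
    conv_rhs => rw [← List.attach_map_subtype_val idx, List.map_map]
    refine List.map_congr_left fun i _ => ?_
    simp [hg]
  have hfs : Function.Injective (Sym2.map f) := Sym2.map.injective f.injective
  refine ⟨l, ?_, fun e => ?_, ?_⟩
  · refine List.Nodup.of_map (Sym2.map f) ?_
    rw [hlsym]
    refine List.Nodup.map_on (fun i hi j hj h => ?_) (List.nodup_range.filter _)
    exact hE.inj i ((hmemidx i).1 hi).1 j ((hmemidx j).1 hj).1 h
  · rw [← List.mem_map_of_injective hfs, hlsym]
    induction e with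
    | _ a b =>
      rw [SimpleGraph.mem_edgeSet, numberedGraph, SimpleGraph.comap_adj, ← hf, hE.adj_iff,
        Sym2.map_mk, List.mem_map]
      constructor
      · rintro ⟨i, hi, h⟩
        have h1 : f a ∈ R := Finset.orderEmbOfFin_mem _ _ _
        have h2 : f b ∈ R := Finset.orderEmbOfFin_mem _ _ _
        refine ⟨i, (hmemidx i).2 ⟨hi, ?_⟩, h⟩
        rcases Sym2.eq_iff.1 h with ⟨h3, h4⟩ | ⟨h3, h4⟩
        · rw [h3, h4]
          exact ⟨h1, h2⟩
        · rw [h3, h4]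
          exact ⟨h2, h1⟩
      · rintro ⟨i, hi, h⟩
        exact ⟨i, ((hmemidx i).1 hi).1, h⟩
  · rw [hlval, List.length_map, List.flatMap_map]

theorem outputs_of_output {n k : ℕ} {L : List (ℕ × ℕ)} {s : RAMState} (h : Output n k L s) :
    s.Outputs (n :: k :: L.length :: L.flatMap fun e => [e.1, e.2]) := by
  intro i hi
  match i with
  | 0 => simpa using h.n_eq
  | 1 => simpa using h.k_eq
  | 2 => simpa using h.m_eq
  | i + 3 =>
    have := eq_getElem_flatMap_pair id L (fun j => s.arr 1 (3 + j))
      (fun j hj => ⟨h.fst_eq j hj, h.snd_eq j hj⟩) i (by simpa using hi)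
    simpa [add_comm 3 i] using this

theorem hasDominatingSet_min_iff {n k : ℕ} (G : SimpleGraph (Fin n)) :
    HasDominatingSet G k ↔ HasDominatingSet G (min k n) := by
  constructor
  · rintro ⟨S, hS, hdom⟩
    exact ⟨S, le_min hS (by simpa using S.card_le_univ), hdom⟩
  · rintro ⟨S, hS, hdom⟩
    exact ⟨S, hS.trans (min_le_left _ _), hdom⟩

theorem capSeq_mono {k k' : ℕ} (h : k ≤ k') (d j : ℕ) : capSeq k d j ≤ capSeq k' d j := by
  induction j with
  | zero => rfl
  | succ j ih =>
    simp only [capSeq]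
    gcongr

theorem kernelize_time_le {n m d : ℕ} (hd : 1 ≤ d) (hm : m ≤ d * n) :
    n * (2 ^ d * (220 * (n + (m + m) + 1))) + 20 * (n + (m + m) + 1) +
      31 * m + 6 * n + (d + 1) * (4 * n + 10) + 36 ≤ 2000 * (2 ^ d * d * (max n 1) ^ 2) := by
  set N := max n 1 with hN
  have hn : n ≤ N := le_max_left _ _
  have h1 : 1 ≤ N := le_max_right _ _
  have hdN : N ≤ d * N := Nat.le_mul_of_pos_left _ hd
  have hm' : m ≤ d * N := hm.trans (Nat.mul_le_mul_left _ hn)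
  have hL : n + (m + m) + 1 ≤ 4 * (d * N) := by omega
  have hX : d * N ≤ 2 ^ d * d * N ^ 2 := by
    calc d * N ≤ 2 ^ d * (d * N) := Nat.le_mul_of_pos_left _ (by positivity)
      _ ≤ 2 ^ d * (d * N) * N := Nat.le_mul_of_pos_right _ h1
      _ = _ := by ring
  have hA : n * (2 ^ d * (220 * (n + (m + m) + 1))) ≤ 880 * (2 ^ d * d * N ^ 2) := by
    calc n * (2 ^ d * (220 * (n + (m + m) + 1))) ≤ N * (2 ^ d * (220 * (4 * (d * N)))) := by gcongr
      _ = _ := by ring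
  have hB : (d + 1) * (4 * n + 10) ≤ 28 * (d * N) := by
    calc (d + 1) * (4 * n + 10) ≤ (2 * d) * (14 * N) :=
          Nat.mul_le_mul (by omega) (by omega)
      _ = _ := by ring
  omega

theorem theorem2 :
    ∃ C : ℕ, ∀ d : ℕ, 1 ≤ d →
      ∃ (P : RAMProg) (h : ℕ → ℕ),
        IsDominatingSetKernelization d P
          (fun n => C * (2 ^ d * d * (max n 1) ^ 2))
          (fun k => C * ((d + 2) ^ (2 * (d + 2)) * k ^ (2 * (d + 1) ^ 2)))
          h := by
  refine ⟨2000, fun d hd => ⟨kernelize d, id, ?_⟩⟩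
  intro n G k w hG hk hw
  obtain ⟨l, hnd, hmem, rfl⟩ := hw
  set H := G.map Fin.valEmbedding with hH
  set w := n :: k :: l.length :: l.flatMap fun e => [(e.1 : ℕ), (e.2 : ℕ)] with hw
  have hpair := getD_flatMap_pair (fun x : Fin n => (x : ℕ)) l
  set S : ℕ → ℕ := fun i => w.getD (3 + 2 * i) 0 with hS
  set T : ℕ → ℕ := fun i => w.getD (3 + (2 * i + 1)) 0 with hT
  have hSi : ∀ i (hi : i < l.length), S i = l[i].1 := fun i hi => by
    rw [← (hpair i hi).1]
    simp [hS, hw, add_comm 3]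
  have hTi : ∀ i (hi : i < l.length), T i = l[i].2 := fun i hi => by
    rw [← (hpair i hi).2]
    simp [hT, hw, add_comm 3]
  have hE : EdgeList H n l.length S T := edgeList_of_encodes hnd hmem hSi hTi
  have hdeg : DegenerateOn H (Finset.range n) d := ((isDegenerate_iff G d).1 hG).map_val
  have hm : l.length ≤ d * n := by
    rw [← ncard_edgeSet_eq_length hnd hmem]
    exact hG.ncard_edgeSet_le
  have hin : Input n k l.length S T (RAMState.init w) :=
    ⟨by simp [RAMState.init, hw], by simp [RAMState.init, hw], by simp [RAMState.init, hw],
      fun i _ => by simp [RAMState.init, hS], fun i _ => by simp [RAMState.init, hT]⟩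
  obtain ⟨t, s', hexec, ht, pos, B, hpos, hB, hsp, hsat, hout⟩ :=
    kernelize_runs hE hdeg hin (fun A hA i => by simp [RAMState.init, hA])
  set R := retained H n B with hR
  have hRn : R ⊆ Finset.range n := Finset.filter_subset _ _
  have hG' : IsDegenerate (numberedGraph H R) d :=
    (isDegenerate_iff _ d).2 (hdeg.comap (R.orderEmbOfFin rfl).toEmbedding
      fun i => hRn (Finset.orderEmbOfFin_mem _ _ _))
  have hBcard : B.card ≤ capSeq k d (d + 1) := by
    have := hsp ∅
    simp only [above, Finset.empty_subset, Finset.filter_true, Finset.card_empty,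
      Nat.sub_zero] at this
    exact this.trans (capSeq_mono (min_le_left _ _) _ _)
  have hsize := kernel_size_le hd hk hBcard (card_retained_le hdeg hB)
  have hedges := hG'.ncard_edgeSet_le
  refine ⟨t, s', hexec, ht.trans (kernelize_time_le hd hm), R.card, numberedGraph H R, min k n, _,
    encodes_numberedGraph hE, outputs_of_output hout, hG', ?_, ?_, min_le_left _ _, ?_⟩
  · exact hsize.2.trans (Nat.mul_le_mul_right _ (by norm_num))
  · exact hedges.trans (hsize.1.trans (Nat.mul_le_mul_right _ (by norm_num)))
  · have hlt : ∀ x y, H.Adj x y → x < n ∧ y < n := by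
      intro x y hxy
      obtain ⟨u, v, -, rfl, rfl⟩ := (map_val_adj G x y).1 hxy
      exact ⟨u.2, v.2⟩
    have h1 : HasDominatingSet G (min k n) ↔ HasDominatingSetOn H (Finset.range n) (min k n) := by
      rw [← hasDominatingSet_comap_iff H (Finset.range n) Fin.valEmbedding (fun v => ?_), hH,
        SimpleGraph.comap_map_eq]
      rw [Finset.mem_range]
      exact ⟨fun h => ⟨⟨v, h⟩, rfl⟩, fun ⟨u, hu⟩ => hu ▸ u.2⟩
    have h2 : HasDominatingSet (numberedGraph H R) (min k n) ↔
        HasDominatingSetOn H R (min k n) :=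
      hasDominatingSet_comap_iff H R (R.orderEmbOfFin rfl).toEmbedding
        (fun v => mem_iff_exists_orderEmbOfFin R v) _
    rw [hasDominatingSet_min_iff, h1, h2]
    exact hasDominatingSetOn_retained_iff hlt hpos hB hsp hsat
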